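/- For a finite group $G$, let $\operatorname{rdim}(G)$ denote the minimal dimension of a faithful complex linear representation of $G$. For a prime $p$ and an integer $n\ge 1$ put \[ f_p(n) := \max_{1\le r\le n}\; r\,p^{\lfloor (n-r)/2\rfloor}. \] **Theorem 1.1.** Let $p$ be a prime and let $n$ be a positive integer. The maximal value of $\operatorname{rdim}(G)$, as $G$ ranges over all groups of order $p^n$, equals $f_p(n)$ if and only if $(p,n)$ is not one of the exceptional pairs $(2,5)$, $(2,7)$, and $(p,4)$ with $p$ odd. In these exceptional cases the maximal value of $\operatorname{rdim}(G)$ is $5$, $10$ and $p+1$, respectively. -/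

import Mathlib

universe u

/-- The representation dimension of a finite group `G`: the minimal dimension `d` of a faithful
complex linear representation of `G`. Up to isomorphism, the underlying space of a `d`-dimensional
representation is `Fin d → ℂ`. -/
noncomputable def rdim (G : Type u) [Group G] : ℕ :=
  sInf {d : ℕ | ∃ ρ : Representation ℂ G (Fin d → ℂ), Function.Injective ρ}

/-- The set of values of `rdim G`, as `G` ranges over all groups of order `m`. -/
def rdimValues (m : ℕ) : Set ℕ :=
  {d : ℕ | ∃ (G : Type u) (_ : Group G), Nat.card G = m ∧ rdim G = d}

/-- `f_p(n) = max_{1 ≤ r ≤ n} r * p ^ ⌊(n - r) / 2⌋`. Both the subtraction and the division take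
place in `ℕ`; since `r ≤ n`, this is the usual floor of `(n - r) / 2`. -/
def fMax (p n : ℕ) : ℕ :=
  (Finset.Icc 1 n).sup fun r => r * p ^ ((n - r) / 2)

/-- The exceptional pairs `(2, 5)`, `(2, 7)` and `(p, 4)` with `p` odd. -/
def IsExceptional (p n : ℕ) : Prop :=
  (p = 2 ∧ n = 5) ∨ (p = 2 ∧ n = 7) ∨ (Odd p ∧ n = 4)

open scoped commutatorElement IsMulCommutative

/-! Upper bound. Let `G` have order `p ^ n` and centre `Z` of order `p ^ s`. A normal subgroup of a
`p`-group that meets the centre trivially is trivial, so a representation is faithful as soon as it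
is faithful on `Z`. At most `s` characters of `Z` are needed to separate its points. Each of them
extends to a character of a subgroup `H ≥ Z` with `|G| |Z| ≤ |H| ^ 2`
(`IsPGroup.exists_extension_card_le_sq`, a polarization argument), hence of index at most `p ^ ((n -
s) / 2)`. Summing the induced representations gives `rdim G ≤ s * p ^ ((n - s) / 2)`, and so `rdim G
≤ fMax p n`.

In the exceptional cases one value of `s` violates the claimed bound: 3 for orders 32 and 128, 2 for
order `p ^ 4`. If some noncentral `x` in the second centre has `[x, G] ≠ Z`, a nontrivial character
of `Z` killing `[x, G]` extends first to `⟨Z, x⟩`, which lowers the exponent bounding one summand.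
For orders 32 and `p ^ 4`, counting shows `[x, G] ≠ Z`. For order 128 with `Z` elementary, `[x, G] =
Z` for all such `x` would make the commutator an alternating map from a 4-dimensional to a
3-dimensional space over `ZMod 2` vanishing only on dependent pairs;
`no_anisotropic_alternating_map` excludes this. If `Z` is not elementary, two characters suffice and
the bound is 8.

Lower bound. The examples are central extensions of `V` by an elementary abelian `Z` given by a
bilinear cocycle. A faithful representation, restricted to `Z`, has at least `rank Z` nontrivial
weights, and each weight space is `G`-stable. A trace argument (`card_le_finrank_sq`) makes many
group elements act linearly independently on it, so it is large (`CentralExt.le_rdim`). Heisenberg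
groups over `GF(p ^ m)` with centre cut down to rank `r ≤ m` attain `r * p ^ m`; elementary abelian
groups and two special constructions cover the small orders. The maximum defining `fMax` is at `r =
1`, `2` or `3`, and the exceptional pairs are those where neither general family reaches it. -/

/-! ### Linear characters of subgroups and their extensions. -/

/-- `ψ` is multiplicative on the subgroup `A`, i.e. restricts to a linear character of `A`. -/
def IsCharOn {G : Type*} [Group G] (A : Subgroup G) (ψ : G → ℂˣ) : Prop :=
  ∀ a ∈ A, ∀ b ∈ A, ψ (a * b) = ψ a * ψ b

namespace IsCharOn

variable {G : Type*} [Group G] {A : Subgroup G} {ψ : G → ℂˣ}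

theorem map_one (h : IsCharOn A ψ) : ψ 1 = 1 := by
  have := h 1 A.one_mem 1 A.one_mem
  simpa using this

theorem map_inv (h : IsCharOn A ψ) {a : G} (ha : a ∈ A) : ψ a⁻¹ = (ψ a)⁻¹ := by
  have := h a ha a⁻¹ (A.inv_mem ha)
  rw [mul_inv_cancel, h.map_one] at this
  exact eq_inv_of_mul_eq_one_right this.symm

theorem map_pow (h : IsCharOn A ψ) {a : G} (ha : a ∈ A) (k : ℕ) : ψ (a ^ k) = ψ a ^ k := by
  induction k with
  | zero => simp [h.map_one]
  | succ k ih => rw [pow_succ, h _ (A.pow_mem ha k) _ ha, ih, pow_succ]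

/-- The linear character as a homomorphism. -/
def toHom (h : IsCharOn A ψ) : A →* ℂˣ where
  toFun a := ψ a
  map_one' := h.map_one
  map_mul' a b := h a a.2 b b.2

theorem of_hom (χ : A →* ℂˣ) : ∃ ψ : G → ℂˣ, IsCharOn A ψ ∧ ∀ a : A, ψ a = χ a := by
  classical
  refine ⟨fun g => if h : g ∈ A then χ ⟨g, h⟩ else 1, ?_, ?_⟩
  · intro a ha b hb
    simp only [ha, hb, A.mul_mem ha hb, dif_pos]
    rw [← map_mul]; rfl
  · intro a; simp

end IsCharOn

/-- Since `χ` kills the commutator subgroup, it factors through the image of `A` in the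
abelianization, and characters of subgroups of finite abelian groups extend. -/
theorem exists_monoidHom_extension_of_commutator {G : Type*} [Group G] [Finite G]
    {A : Subgroup G} (χ : A →* ℂˣ)
    (hc : ∀ g h : G, ∃ hm : ⁅g, h⁆ ∈ A, χ ⟨⁅g, h⁆, hm⟩ = 1) :
    ∃ ξ : G →* ℂˣ, ∀ a : A, ξ a = χ a := by
  classical
  let f : A →* Abelianization G := Abelianization.of.comp A.subtype
  have hker : f.rangeRestrict.ker ≤ χ.ker := by
    intro a ha
    have h1 : (a : G) ∈ commutator G := by
      rw [MonoidHom.ker_rangeRestrict] at ha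
      have : Abelianization.of (a : G) = 1 := ha
      rwa [← MonoidHom.mem_ker, Abelianization.ker_of] at this
    have h2 : commutator G ≤ χ.ker.map A.subtype := by
      rw [commutator_def, Subgroup.commutator_le]
      intro g _ h _
      obtain ⟨hm, h1⟩ := hc g h
      exact ⟨⟨_, hm⟩, h1, rfl⟩
    obtain ⟨b, hb, hba⟩ := h2 h1
    have : b = a := Subtype.ext hba
    exact this ▸ hb
  let η : f.range →* ℂˣ :=
    f.rangeRestrict.liftOfSurjective f.rangeRestrict_surjective ⟨χ, hker⟩
  obtain ⟨ξ, hξ⟩ := MonoidHom.domRestrict_surjective (M := ℂ) f.range η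
  refine ⟨ξ.comp Abelianization.of, fun a => ?_⟩
  have h1 := DFunLike.congr_fun hξ (f.rangeRestrict a)
  have h2 : η (f.rangeRestrict a) = χ a :=
    f.rangeRestrict.liftOfRightInverse_comp_apply _ _ ⟨χ, hker⟩ a
  rw [h2] at h1
  exact h1

theorem IsCharOn.exists_extension {G : Type*} [Group G] [Finite G] {A B : Subgroup G}
    (hAB : A ≤ B) {ψ : G → ℂˣ} (hψ : IsCharOn A ψ)
    (hc : ∀ g ∈ B, ∀ h ∈ B, ⁅g, h⁆ ∈ A ∧ ψ ⁅g, h⁆ = 1) :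
    ∃ ψ' : G → ℂˣ, IsCharOn B ψ' ∧ ∀ a ∈ A, ψ' a = ψ a := by
  let χ : A.subgroupOf B →* ℂˣ :=
    hψ.toHom.comp (Subgroup.subgroupOfEquivOfLe hAB).toMonoidHom
  obtain ⟨ξ, hξ⟩ := exists_monoidHom_extension_of_commutator χ (fun g h =>
    ⟨(hc g g.2 h h.2).1, (hc g g.2 h h.2).2⟩)
  obtain ⟨ψ', h1, h2⟩ := IsCharOn.of_hom ξ
  refine ⟨ψ', h1, fun a ha => ?_⟩
  exact (h2 ⟨a, hAB ha⟩).trans (hξ ⟨⟨a, hAB ha⟩, ha⟩)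

theorem commutator_mem_of_forall_generator {G : Type*} [Group G] {K : Subgroup G} {S : Set G}
    (hK : ∀ g ∈ Subgroup.closure S, ∀ k ∈ K, g * k * g⁻¹ ∈ K) {g : G}
    (hS : ∀ s ∈ S, ⁅g, s⁆ ∈ K) {h : G} (hh : h ∈ Subgroup.closure S) : ⁅g, h⁆ ∈ K := by
  induction hh using Subgroup.closure_induction with
  | mem s hs => exact hS s hs
  | one => simp
  | mul a b ha hb iha ihb =>
    have : ⁅g, a * b⁆ = ⁅g, a⁆ * (a * ⁅g, b⁆ * a⁻¹) := by
      simp only [commutatorElement_def]; group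
    rw [this]; exact K.mul_mem iha (hK a ha _ ihb)
  | inv a ha iha =>
    have : ⁅g, a⁻¹⁆ = a⁻¹ * (⁅g, a⁆)⁻¹ * (a⁻¹)⁻¹ := by
      simp only [commutatorElement_def]; group
    rw [this]; exact hK _ (Subgroup.inv_mem _ ha) _ (K.inv_mem iha)

theorem commutator_mem_of_mem_closure {G : Type*} [Group G] {K : Subgroup G} {S : Set G}
    (hK : ∀ g ∈ Subgroup.closure S, ∀ k ∈ K, g * k * g⁻¹ ∈ K)
    (hS : ∀ s ∈ S, ∀ t ∈ S, ⁅s, t⁆ ∈ K) :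
    ∀ g ∈ Subgroup.closure S, ∀ h ∈ Subgroup.closure S, ⁅g, h⁆ ∈ K := by
  intro g hg h hh
  refine commutator_mem_of_forall_generator hK (fun s hs => ?_) hh
  rw [← commutatorElement_inv]
  exact K.inv_mem (commutator_mem_of_forall_generator hK (hS s hs) hg)

/-- An invariant linear character of `A` extends to `⟨A, x⟩` as soon as `x` fixes it. -/
theorem IsCharOn.exists_extension_insert {G : Type*} [Group G] [Finite G] {A : Subgroup G}
    {ψ : G → ℂˣ} (hψ : IsCharOn A ψ) (x : G)
    (hx : ∀ a ∈ A, ⁅x, a⁆ ∈ A ∧ ψ ⁅x, a⁆ = 1) :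
    ∃ ψ' : G → ℂˣ, IsCharOn (Subgroup.closure (insert x (A : Set G))) ψ' ∧
      ∀ a ∈ A, ψ' a = ψ a := by
  -- `K` is the kernel of `ψ` in `A`; the aim is that `⟨A, x⟩` is commutative modulo `K`.
  let K : Subgroup G := hψ.toHom.ker.map A.subtype
  have hKmem : ∀ k, k ∈ K ↔ k ∈ A ∧ ψ k = 1 := by
    intro k
    constructor
    · rintro ⟨a, ha, rfl⟩; exact ⟨a.2, ha⟩
    · rintro ⟨h1, h2⟩; exact ⟨⟨k, h1⟩, h2, rfl⟩
  have hAA : ∀ a ∈ A, ∀ b ∈ A, ⁅a, b⁆ ∈ K := by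
    intro a ha b hb
    refine (hKmem _).2 ⟨?_, ?_⟩
    · exact A.mul_mem (A.mul_mem (A.mul_mem ha hb) (A.inv_mem ha)) (A.inv_mem hb)
    · rw [commutatorElement_def, hψ _ (A.mul_mem (A.mul_mem ha hb) (A.inv_mem ha)) _ (A.inv_mem hb),
        hψ _ (A.mul_mem ha hb) _ (A.inv_mem ha), hψ _ ha _ hb, hψ.map_inv ha, hψ.map_inv hb]
      rw [mul_comm (ψ a)]; group
  have hxA : ∀ a ∈ A, ⁅x, a⁆ ∈ K := fun a ha => (hKmem _).2 (hx a ha)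
  have hKA : K ≤ A := fun k hk => ((hKmem k).1 hk).1
  have hnorm : ∀ g ∈ Subgroup.closure (insert x (A : Set G)), ∀ a ∈ A, ⁅g, a⁆ ∈ K := by
    have h1 : ∀ k ∈ K, x * k * x⁻¹ ∈ K := fun k hk => by
      have := K.mul_mem (hxA k (hKA hk)) hk
      simpa [commutatorElement_def] using this
    have hxa : ∀ a ∈ A, x * a * x⁻¹ ∈ A := fun a ha => by
      have := A.mul_mem (hx a ha).1 ha
      simpa [commutatorElement_def] using this
    -- Finiteness turns `gAg⁻¹ ⊆ A` into an equality, which the inverse case of the closure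
    -- induction needs.
    have hfin : ∀ g, (∀ a ∈ A, g * a * g⁻¹ ∈ A) → ∀ a ∈ A, g⁻¹ * a * g ∈ A := by
      intro g hg a ha
      have hinj : Function.Injective (fun b : A => (⟨g * b * g⁻¹, hg b b.2⟩ : A)) := by
        intro b c hbc
        exact Subtype.ext (by simpa using congrArg Subtype.val hbc)
      obtain ⟨b, hb⟩ := Finite.surjective_of_injective hinj ⟨a, ha⟩
      have : g * b * g⁻¹ = a := congrArg Subtype.val hb
      rw [← this]; simp [mul_assoc]
    intro g hg
    have key : (∀ a ∈ A, g * a * g⁻¹ ∈ A) ∧ ∀ a ∈ A, ψ (g * a * g⁻¹) = ψ a := by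
      induction hg using Subgroup.closure_induction with
      | mem s hs =>
        rcases hs with rfl | hs
        · refine ⟨hxa, fun a ha => ?_⟩
          have h2 := hψ _ (hx a ha).1 _ ha
          rw [(hx a ha).2, one_mul] at h2
          simpa [commutatorElement_def] using h2
        · refine ⟨fun a ha => A.mul_mem (A.mul_mem hs ha) (A.inv_mem hs), fun a ha => ?_⟩
          rw [hψ _ (A.mul_mem hs ha) _ (A.inv_mem hs), hψ _ hs _ ha, hψ.map_inv hs]
          rw [mul_comm (ψ s)]; simp
      | one => simp
      | mul g h _ _ ihg ihh =>
        have e : ∀ a, g * h * a * (g * h)⁻¹ = g * (h * a * h⁻¹) * g⁻¹ := by intro a; group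
        refine ⟨fun a ha => ?_, fun a ha => ?_⟩
        · rw [e]; exact ihg.1 _ (ihh.1 a ha)
        · rw [e, ihg.2 _ (ihh.1 a ha), ihh.2 a ha]
      | inv g _ ihg =>
        have := hfin g ihg.1
        refine ⟨fun a ha => by simpa using this a ha, fun a ha => ?_⟩
        rw [← ihg.2 (g⁻¹ * a * g⁻¹⁻¹) (by simpa using this a ha)]
        congr 1; group
    intro a ha
    refine (hKmem _).2 ⟨A.mul_mem (key.1 a ha) (A.inv_mem ha), ?_⟩
    rw [commutatorElement_def, hψ _ (key.1 a ha) _ (A.inv_mem ha), key.2 a ha, hψ.map_inv ha,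
      mul_inv_cancel]
  have hAB : A ≤ Subgroup.closure (insert x (A : Set G)) := fun a ha =>
    Subgroup.subset_closure (Or.inr ha)
  refine hψ.exists_extension hAB ?_
  have := commutator_mem_of_mem_closure (K := K) (S := insert x (A : Set G)) ?_ ?_
  · intro g hg h hh; exact (hKmem _).1 (this g hg h hh)
  · intro g hg k hk
    have := K.mul_mem (hnorm g hg k (hKA hk)) hk
    simpa [commutatorElement_def] using this
  · rintro s (rfl | hs) t (rfl | ht)
    · simp
    · exact hxA t ht
    · rw [← commutatorElement_inv]; exact K.inv_mem (hxA s hs)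
    · exact hAA s hs t ht

/-! ### Polarization in `p`-groups. -/

/-- Lift an element of order `p` from the centre of `G ⧸ N`. -/
theorem IsPGroup.exists_commutator_mem_of_ne_top {p : ℕ} [Fact p.Prime] {G : Type*} [Group G]
    [Finite G] (hG : IsPGroup p G) (N : Subgroup G) [N.Normal] (hN : N ≠ ⊤) :
    ∃ x, x ∉ N ∧ x ^ p ∈ N ∧ ∀ g, ⁅x, g⁆ ∈ N := by
  have : Nontrivial (G ⧸ N) := QuotientGroup.nontrivial_iff.2 hN
  have hQ : IsPGroup p (G ⧸ N) := hG.to_quotient N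
  have := hQ.center_nontrivial
  obtain ⟨n, hn, hcard⟩ := (IsPGroup.nontrivial_iff_card (hQ.to_subgroup _)).1 this
  obtain ⟨z, hz⟩ := exists_prime_orderOf_dvd_card' (G := Subgroup.center (G ⧸ N)) p
    (hcard ▸ dvd_pow_self p hn.ne')
  obtain ⟨x, hx⟩ := QuotientGroup.mk_surjective (z : G ⧸ N)
  refine ⟨x, fun hxN => ?_, ?_, fun g => ?_⟩
  · have : (z : G ⧸ N) = 1 := by rw [← hx]; exact (QuotientGroup.eq_one_iff x).2 hxN
    have : z = 1 := Subtype.ext this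
    rw [this, orderOf_one] at hz
    exact (Fact.out : p.Prime).one_lt.ne hz
  · rw [← QuotientGroup.eq_one_iff, QuotientGroup.mk_pow, hx]
    have := pow_orderOf_eq_one z
    rw [hz] at this
    exact congrArg Subtype.val this
  · rw [← QuotientGroup.eq_one_iff]
    have h1 := Subgroup.mem_center_iff.1 z.2 (g : G ⧸ N)
    rw [← hx] at h1
    have : ((⁅x, g⁆ : G) : G ⧸ N) = ⁅(x : G ⧸ N), (g : G ⧸ N)⁆ := rfl
    rw [this, commutatorElement_eq_one_iff_mul_comm]
    exact h1.symm

theorem IsPGroup.exists_commutator_mem_of_lt {p : ℕ} [Fact p.Prime] {G : Type*} [Group G]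
    [Finite G] (hG : IsPGroup p G) {A M : Subgroup G} (hAM : A < M)
    (hn : ∀ g ∈ M, ∀ a ∈ A, g * a * g⁻¹ ∈ A) :
    ∃ x ∈ M, x ∉ A ∧ x ^ p ∈ A ∧ ∀ g ∈ M, ⁅x, g⁆ ∈ A := by
  have : (A.subgroupOf M).Normal := ⟨fun a ha g => hn g g.2 a ha⟩
  obtain ⟨x, h1, h2, h3⟩ := (hG.to_subgroup M).exists_commutator_mem_of_ne_top (A.subgroupOf M)
    (fun h => hAM.not_ge (Subgroup.subgroupOf_eq_top.1 h))
  exact ⟨x, x.2, h1, h2, fun g hg => h3 ⟨g, hg⟩⟩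

theorem IsPGroup.mul_card_le_of_lt {p : ℕ} [Fact p.Prime] {G : Type*} [Group G]
    [Finite G] (hG : IsPGroup p G) {A B : Subgroup G} (h : A < B) :
    p * Nat.card A ≤ Nat.card B := by
  have hp : p.Prime := Fact.out
  obtain ⟨a, ha⟩ := IsPGroup.iff_card.1 (hG.to_subgroup A)
  obtain ⟨b, hb⟩ := IsPGroup.iff_card.1 (hG.to_subgroup B)
  have hlt : Nat.card A < Nat.card B := Set.Finite.card_lt_card (Set.toFinite (B : Set G)) h
  rw [ha, hb] at *
  rw [← pow_succ']
  exact Nat.pow_le_pow_right hp.pos ((Nat.pow_lt_pow_iff_right hp.one_lt).1 hlt)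

theorem MonoidHom.card_le_mul_card_ker_of_pow_eq_one {p : ℕ} (hp : p ≠ 0) {M : Type*} [Group M]
    [Finite M] (θ : M →* ℂˣ) (hθ : ∀ g, θ g ^ p = 1) : Nat.card M ≤ p * Nat.card θ.ker := by
  have : NeZero p := ⟨hp⟩
  have h1 : θ.range ≤ rootsOfUnity p ℂ := by
    rintro _ ⟨g, rfl⟩
    exact (mem_rootsOfUnity p _).2 (hθ g)
  have h2 : Nat.card θ.range ≤ p :=
    (Nat.card_mono (inferInstanceAs (Finite (rootsOfUnity p ℂ))) h1).trans (card_rootsOfUnity ℂ p)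
  have h3 := θ.ker.card_mul_index
  rw [Subgroup.index_ker] at h3
  rw [← h3, mul_comm]
  exact Nat.mul_le_mul_right _ h2

/-- Induction replacing `(A, M)` by `(⟨A, x⟩, M')`, where `x` is central of order `p` modulo `A` and
`M'` is the stabilizer in `M` of the extended character. The first order grows by a factor at least
`p` and the second drops by a factor at most `p`, so `|M| |A|` does not decrease until `A = M`. -/
theorem IsPGroup.exists_extension_card_le_sq {p : ℕ} [Fact p.Prime] {G : Type*} [Group G]
    [Finite G] (hG : IsPGroup p G) {A M : Subgroup G} {ψ : G → ℂˣ} (hAM : A ≤ M)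
    (hψ : IsCharOn A ψ) (hinv : ∀ g ∈ M, ∀ a ∈ A, ⁅g, a⁆ ∈ A ∧ ψ ⁅g, a⁆ = 1) :
    ∃ (H : Subgroup G) (χ : G → ℂˣ), A ≤ H ∧ IsCharOn H χ ∧ (∀ a ∈ A, χ a = ψ a) ∧
      Nat.card M * Nat.card A ≤ Nat.card H ^ 2 := by
  have hp : p.Prime := Fact.out
  induction hn : Nat.card G - Nat.card A using Nat.strong_induction_on generalizing A M ψ with
  | _ n ih =>
  rcases hAM.eq_or_lt with rfl | hlt
  · exact ⟨A, ψ, le_rfl, hψ, fun _ _ => rfl, (sq _).ge⟩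
  have hconj : ∀ g ∈ M, ∀ a ∈ A, g * a * g⁻¹ ∈ A ∧ ψ (g * a * g⁻¹) = ψ a := by
    intro g hg a ha
    have h1 := hinv g hg a ha
    have e : ⁅g, a⁆ * a = g * a * g⁻¹ := by simp [commutatorElement_def]
    rw [← e]
    exact ⟨A.mul_mem h1.1 ha, by rw [hψ _ h1.1 _ ha, h1.2, one_mul]⟩
  obtain ⟨x, hxM, hxA, hxp, hxc⟩ := hG.exists_commutator_mem_of_lt hlt fun g hg a ha =>
    (hconj g hg a ha).1
  -- `θ` is a homomorphism because `M` fixes `ψ`; its values are `p`-th roots of unity because `x ^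
  -- p ∈ A`.
  let θ : M →* ℂˣ :=
    { toFun := fun g => ψ ⁅x, g⁆
      map_one' := by simp [hψ.map_one]
      map_mul' := fun g h => by
        have : ⁅x, (g * h : G)⁆ = ⁅x, (g : G)⁆ * (g * ⁅x, (h : G)⁆ * (g : G)⁻¹) := by
          simp only [commutatorElement_def]; group
        have h1 := hconj g g.2 _ (hxc h h.2)
        rw [Subgroup.coe_mul, this, hψ _ (hxc g g.2) _ h1.1, h1.2] }
  have hθp : ∀ g, θ g ^ p = 1 := by
    intro g
    have key : ∀ k : ℕ, ⁅x ^ k, (g : G)⁆ ∈ A ∧ ψ ⁅x ^ k, (g : G)⁆ = ψ ⁅x, (g : G)⁆ ^ k := by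
      intro k
      induction k with
      | zero => simp [hψ.map_one, A.one_mem]
      | succ k ihk =>
        have : ⁅x ^ (k + 1), (g : G)⁆ = (x * ⁅x ^ k, (g : G)⁆ * x⁻¹) * ⁅x, (g : G)⁆ := by
          simp only [commutatorElement_def, pow_succ']; group
        have h1 := hconj x hxM _ ihk.1
        rw [this, hψ _ h1.1 _ (hxc g g.2), h1.2, ihk.2, pow_succ]
        exact ⟨A.mul_mem h1.1 (hxc g g.2), rfl⟩
    have h1 := hinv g g.2 _ hxp
    have h2 := hψ.map_inv h1.1
    rw [h1.2, commutatorElement_inv, (key p).2, inv_one] at h2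
    exact h2
  have hcardM := θ.card_le_mul_card_ker_of_pow_eq_one hp.ne_zero hθp
  let M' : Subgroup G := θ.ker.map M.subtype
  have hM'card : Nat.card M' = Nat.card θ.ker :=
    (Nat.card_congr (θ.ker.equivMapOfInjective M.subtype M.subtype_injective).toEquiv).symm
  have hM'mem : ∀ g, g ∈ M' ↔ g ∈ M ∧ ψ ⁅x, g⁆ = 1 := by
    intro g
    constructor
    · rintro ⟨a, ha, rfl⟩; exact ⟨a.2, ha⟩
    · rintro ⟨h1, h2⟩; exact ⟨⟨g, h1⟩, h2, rfl⟩
  let K : Subgroup G := hψ.toHom.ker.map A.subtype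
  have hKmem : ∀ k, k ∈ K ↔ k ∈ A ∧ ψ k = 1 := by
    intro k
    constructor
    · rintro ⟨a, ha, rfl⟩; exact ⟨a.2, ha⟩
    · rintro ⟨h1, h2⟩; exact ⟨⟨k, h1⟩, h2, rfl⟩
  obtain ⟨ψ', hψ', hext⟩ := hψ.exists_extension_insert x fun a ha => hinv x hxM a ha
  let B := Subgroup.closure (insert x (A : Set G))
  have hAB : A < B := by
    refine lt_of_le_of_ne (fun a ha => Subgroup.subset_closure (Or.inr ha)) fun h => hxA ?_
    rw [h]; exact Subgroup.subset_closure (Or.inl rfl)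
  have hBM' : B ≤ M' := by
    refine (Subgroup.closure_le M').2 ?_
    rintro s (rfl | hs)
    · exact (hM'mem _).2 ⟨hxM, by simp [hψ.map_one]⟩
    · exact (hM'mem _).2 ⟨hAM hs, (hinv x hxM s hs).2⟩
  have hM'M : ∀ g ∈ M', g ∈ M := fun g hg => ((hM'mem g).1 hg).1
  have hinv' : ∀ g ∈ M', ∀ b ∈ B, ⁅g, b⁆ ∈ B ∧ ψ' ⁅g, b⁆ = 1 := by
    intro g hg b hb
    have : ⁅g, b⁆ ∈ K := by
      refine commutator_mem_of_forall_generator (S := insert x (A : Set G)) ?_ ?_ hb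
      · intro h hh k hk
        have h1 := (hKmem k).1 hk
        have h2 := hconj h (hM'M h (hBM' hh)) k h1.1
        exact (hKmem _).2 ⟨h2.1, h2.2.trans h1.2⟩
      · rintro s (rfl | hs)
        · rw [← commutatorElement_inv]
          exact K.inv_mem ((hKmem _).2 ⟨hxc g (hM'M g hg), ((hM'mem g).1 hg).2⟩)
        · exact (hKmem _).2 (hinv g (hM'M g hg) s hs)
    have h1 := (hKmem _).1 this
    exact ⟨hAB.le h1.1, (hext _ h1.1).trans h1.2⟩
  have hAcard := hG.mul_card_le_of_lt hAB
  have hBG : Nat.card B ≤ Nat.card G := Subgroup.card_le_card_group B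
  have hApos : 0 < Nat.card A := Nat.card_pos
  have hlt' : Nat.card A < Nat.card B := by nlinarith [hp.two_le]
  obtain ⟨H, χ, hBH, hχ, hχe, hH⟩ := ih (Nat.card G - Nat.card B) (by omega) hBM' hψ' hinv' rfl
  refine ⟨H, χ, hAB.le.trans hBH, hχ, fun a ha => (hχe a (hAB.le ha)).trans (hext a ha), ?_⟩
  rw [hM'card] at hH
  calc Nat.card M * Nat.card A ≤ p * Nat.card θ.ker * Nat.card A := Nat.mul_le_mul_right _ hcardM
    _ = Nat.card θ.ker * (p * Nat.card A) := by ring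
    _ ≤ Nat.card θ.ker * Nat.card B := Nat.mul_le_mul_left _ hAcard
    _ ≤ _ := hH

/-! ### Representation dimension and induced representations. -/

theorem exists_injective_fin_finrank {G : Type*} [Group G] {W : Type*} [AddCommGroup W]
    [Module ℂ W] [FiniteDimensional ℂ W] (ρ : Representation ℂ G W) (hρ : Function.Injective ρ) :
    ∃ ρ' : Representation ℂ G (Fin (Module.finrank ℂ W) → ℂ), Function.Injective ρ' := by
  let e : W ≃ₗ[ℂ] (Fin (Module.finrank ℂ W) → ℂ) := (Module.finBasis ℂ W).equivFun
  refine ⟨(e.conjRingEquiv : Module.End ℂ W →* _).comp ρ, fun g h hgh => hρ ?_⟩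
  exact e.conjRingEquiv.injective hgh

theorem rdim_le_finrank {G : Type*} [Group G] {W : Type*} [AddCommGroup W] [Module ℂ W]
    [FiniteDimensional ℂ W] (ρ : Representation ℂ G W) (hρ : Function.Injective ρ) :
    rdim G ≤ Module.finrank ℂ W :=
  Nat.sInf_le (exists_injective_fin_finrank ρ hρ)

theorem exists_injective_representation_rdim (G : Type*) [Group G] [Finite G] :
    ∃ ρ : Representation ℂ G (Fin (rdim G) → ℂ), Function.Injective ρ := by
  have hreg : Function.Injective (Representation.ofMulAction ℂ G G) := fun g h hgh => by
    have h1 := LinearMap.congr_fun hgh (MonoidAlgebra.single 1 1)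
    rw [Representation.ofMulAction_single, Representation.ofMulAction_single] at h1
    simpa using MonoidAlgebra.of_injective (R := ℂ) (M := G) h1
  exact Nat.sInf_mem (s := {d : ℕ | ∃ ρ : Representation ℂ G (Fin d → ℂ), Function.Injective ρ})
    ⟨_, exists_injective_fin_finrank _ hreg⟩

theorem rdim_congr {G H : Type*} [Group G] [Group H] (e : G ≃* H) : rdim G = rdim H := by
  refine congrArg sInf (Set.ext fun d => ⟨?_, ?_⟩)
  · rintro ⟨ρ, hρ⟩
    exact ⟨ρ.comp e.symm.toMonoidHom, hρ.comp e.symm.injective⟩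
  · rintro ⟨ρ, hρ⟩
    exact ⟨ρ.comp e.toMonoidHom, hρ.comp e.injective⟩

/-- The functions on `G` that transform under left translation by `H` through `χ`. -/
def charInd {G : Type*} [Group G] (H : Subgroup G) (χ : G → ℂˣ) : Submodule ℂ (G → ℂ) where
  carrier := {f | ∀ h ∈ H, ∀ g, f (h * g) = χ h * f g}
  add_mem' {a b} ha hb h hh g := by simp [ha h hh g, hb h hh g, mul_add]
  zero_mem' h hh g := by simp
  smul_mem' c f hf h hh g := by simp [hf h hh g, mul_left_comm]

/-- The representation of `G` on `charInd H χ` by right translation. -/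
def charIndRep {G : Type*} [Group G] (H : Subgroup G) (χ : G → ℂˣ) :
    Representation ℂ G (charInd H χ) where
  toFun x :=
    { toFun := fun f => ⟨fun g => f.1 (g * x), fun h hh g => by
        simpa [mul_assoc] using f.2 h hh (g * x)⟩
      map_add' := fun _ _ => rfl
      map_smul' := fun _ _ => rfl }
  map_one' := by ext f g; simp
  map_mul' x y := by ext f g; simp [mul_assoc]

theorem charIndRep_apply {G : Type*} [Group G] (H : Subgroup G) (χ : G → ℂˣ) (x : G)
    (f : charInd H χ) (g : G) : (charIndRep H χ x f).1 g = f.1 (g * x) := rfl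

theorem charIndRep_of_mem_center {G : Type*} [Group G] {H : Subgroup G} {χ : G → ℂˣ} {z : G}
    (hz : z ∈ Subgroup.center G) (hzH : z ∈ H) (f : charInd H χ) :
    charIndRep H χ z f = (χ z : ℂ) • f := by
  ext g
  rw [charIndRep_apply, Subgroup.mem_center_iff.1 hz g, f.2 z hzH g]
  rfl

theorem exists_mem_charInd {G : Type*} [Group G] {H : Subgroup G} {χ : G → ℂˣ}
    (hχ : IsCharOn H χ) : ∃ f : charInd H χ, f ≠ 0 := by
  classical
  refine ⟨⟨fun g => if g ∈ H then (χ g : ℂ) else 0, fun h hh g => ?_⟩, fun hf => ?_⟩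
  · by_cases hg : g ∈ H
    · simp [hg, H.mul_mem hh hg, hχ h hh g hg]
    · simp [hg, H.mul_mem_cancel_left hh]
  · have := congrFun (congrArg Subtype.val hf) 1
    simp [H.one_mem] at this

theorem finrank_charInd_le {G : Type*} [Group G] [Finite G] (H : Subgroup G) (χ : G → ℂˣ) :
    Module.finrank ℂ (charInd H χ) ≤ H.index := by
  have : Fintype (G ⧸ H) := Fintype.ofFinite _
  -- A function in `charInd H χ` is determined on right cosets `Hg`; inverting representatives
  -- passes to the left cosets of `G ⧸ H`.
  let L : charInd H χ →ₗ[ℂ] ((G ⧸ H) → ℂ) :=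
    { toFun := fun f q => f.1 (Quotient.out q)⁻¹
      map_add' := fun _ _ => rfl
      map_smul' := fun _ _ => rfl }
  have hL : Function.Injective L := by
    rw [← LinearMap.ker_eq_bot, LinearMap.ker_eq_bot']
    intro f hf
    ext g
    obtain ⟨h, hh⟩ := QuotientGroup.mk_out_eq_mul H g⁻¹
    have h1 : f.1 (g⁻¹ * h : G)⁻¹ = 0 := by
      rw [← hh]; exact congrFun hf (QuotientGroup.mk g⁻¹)
    have h2 : (g⁻¹ * (h : G))⁻¹ = (h : G)⁻¹ * g := by group
    rw [h2, f.2 _ (H.inv_mem h.2)] at h1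
    simpa using h1
  have := LinearMap.finrank_le_finrank_of_injective hL
  rwa [Module.finrank_fintype_fun_eq_card, ← Nat.card_eq_fintype_card] at this

/-- `G` acts on `N` by conjugation; if `N ≠ ⊥`, then `p` divides its order, and a fixed point other
than 1 exists, which is central. -/
theorem IsPGroup.eq_bot_of_inf_center {p : ℕ} [Fact p.Prime] {G : Type*} [Group G] [Finite G]
    (hG : IsPGroup p G) (N : Subgroup G) [N.Normal]
    (h : ∀ z ∈ N, z ∈ Subgroup.center G → z = 1) : N = ⊥ := by
  by_contra hN
  have hp : p.Prime := Fact.out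
  have : Nontrivial N := (Subgroup.nontrivial_iff_ne_bot N).2 hN
  obtain ⟨n, hn, hc⟩ := (IsPGroup.nontrivial_iff_card (hG.to_subgroup N)).1 this
  have hfix : (1 : N) ∈ MulAction.fixedPoints (ConjAct G) N := by
    intro g; ext; simp
  have hGc : IsPGroup p (ConjAct G) := hG.of_equiv ConjAct.toConjAct
  obtain ⟨b, hb, hb1⟩ := hGc.exists_fixed_point_of_prime_dvd_card_of_fixed_point N
    (hc ▸ dvd_pow_self p hn.ne') hfix
  refine hb1 (Subtype.ext (h b b.2 (Subgroup.mem_center_iff.2 fun g => ?_)).symm)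
  have h1 := congrArg Subtype.val (hb (ConjAct.toConjAct g))
  have h2 : g * (b : G) * g⁻¹ = b := h1
  exact mul_inv_eq_iff_eq_mul.1 h2

/-- The direct sum of the induced representations is faithful: central `z` acts on the `i`-th
summand by the scalar `χ i z`, so the kernel meets the centre trivially. -/
theorem IsPGroup.rdim_le_sum_index {p : ℕ} [Fact p.Prime] {G : Type*} [Group G] [Finite G]
    (hG : IsPGroup p G) {ι : Type*} [Fintype ι] (H : ι → Subgroup G) (χ : ι → G → ℂˣ)
    (hχ : ∀ i, IsCharOn (H i) (χ i)) (hZ : ∀ i, Subgroup.center G ≤ H i)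
    (hinj : ∀ z ∈ Subgroup.center G, (∀ i, χ i z = 1) → z = 1) :
    rdim G ≤ ∑ i, (H i).index := by
  let ρ : Representation ℂ G (∀ i, charInd (H i) (χ i)) :=
    { toFun := fun g => LinearMap.piMap fun i => charIndRep (H i) (χ i) g
      map_one' := by ext; simp
      map_mul' := fun g h => by ext; simp }
  have hρ : ∀ g f i, ρ g f i = charIndRep (H i) (χ i) g (f i) := fun _ _ _ => rfl
  have hker : MonoidHom.ker ρ = ⊥ := by
    refine hG.eq_bot_of_inf_center _ fun z hz hzc => hinj z hzc fun i => ?_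
    classical
    obtain ⟨f, hf⟩ := exists_mem_charInd (hχ i)
    have h1 : ρ z (Pi.single i f) i = f := by
      rw [show ρ z = 1 from hz]; simp
    rw [hρ, Pi.single_eq_same, charIndRep_of_mem_center hzc (hZ i hzc)] at h1
    have h2 : ((χ i z : ℂ) - 1) • f = 0 := (sub_smul _ _ f).trans (by rw [h1, one_smul, sub_self])
    rcases smul_eq_zero.1 h2 with h3 | h3
    · exact Units.ext (sub_eq_zero.1 h3)
    · exact absurd h3 hf
  refine (rdim_le_finrank ρ ((MonoidHom.ker_eq_bot_iff ρ).1 hker)).trans ?_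
  rw [Module.finrank_pi_fintype]
  exact Finset.sum_le_sum fun i _ => finrank_charInd_le _ _

/-! ### Families of characters separating points of an abelian `p`-group. -/

theorem card_ker_dvd_of_ne_one {p : ℕ} [Fact p.Prime] {Z : Type*} [CommGroup Z] [Finite Z] {s : ℕ}
    (hZ : Nat.card Z ∣ p ^ (s + 1)) {φ : Z →* ℂˣ} (hφ : φ ≠ 1) : Nat.card φ.ker ∣ p ^ s := by
  have hp : p.Prime := Fact.out
  obtain ⟨t, ht, hc⟩ := (Nat.dvd_prime_pow hp).1 hZ
  obtain ⟨u, hu, hcu⟩ := (Nat.dvd_prime_pow hp).1 (hc ▸ φ.ker.card_subgroup_dvd_card)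
  rw [hcu]
  refine pow_dvd_pow p (Nat.le_of_lt_succ (lt_of_lt_of_le (lt_of_le_of_ne hu ?_) ht))
  rintro rfl
  refine hφ (MonoidHom.ker_eq_top_iff.1 (Subgroup.eq_top_of_card_eq _ (hcu.trans hc.symm)))

/-- Characters separating the points of `φ.ker` extend to `Z`, and together with `φ` they separate
all points. -/
theorem exists_cons_of_ker {Z : Type*} [CommGroup Z] [Finite Z] {s : ℕ} (φ : Z →* ℂˣ)
    (h : ∃ ψ : Fin s → (φ.ker →* ℂˣ), ∀ z, (∀ i, ψ i z = 1) → z = 1) :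
    ∃ ψ : Fin (s + 1) → (Z →* ℂˣ), ψ 0 = φ ∧ ∀ z, (∀ i, ψ i z = 1) → z = 1 := by
  obtain ⟨ψ, hψ⟩ := h
  choose ξ hξ using fun i => MonoidHom.domRestrict_surjective (M := ℂ) φ.ker (ψ i)
  refine ⟨Fin.cons φ ξ, rfl, fun z hz => ?_⟩
  have h0 : φ z = 1 := hz 0
  have := hψ ⟨z, h0⟩ fun i => by
    rw [← hξ i]; exact hz i.succ
  exact congrArg Subtype.val this

theorem exists_jointly_faithful {p : ℕ} [Fact p.Prime] (s : ℕ) {Z : Type*} [CommGroup Z] [Finite Z]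
    (hZ : Nat.card Z ∣ p ^ s) :
    ∃ ψ : Fin s → (Z →* ℂˣ), ∀ z, (∀ i, ψ i z = 1) → z = 1 := by
  induction s generalizing Z with
  | zero =>
    have := Nat.card_eq_one_iff_unique.1 (Nat.dvd_one.1 (by simpa using hZ))
    have := this.1
    exact ⟨fun _ => 1, fun z _ => Subsingleton.elim _ _⟩
  | succ s ih =>
    by_cases h : ∃ a : Z, a ≠ 1
    · obtain ⟨a, ha⟩ := h
      obtain ⟨φ, hφ⟩ := CommGroup.exists_apply_ne_one_of_hasEnoughRootsOfUnity Z ℂ ha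
      obtain ⟨ψ, -, hψ⟩ := exists_cons_of_ker φ
        (ih (card_ker_dvd_of_ne_one hZ fun h => hφ (by rw [h]; rfl)))
      exact ⟨ψ, hψ⟩
    · push Not at h
      exact ⟨fun _ => 1, fun z _ => h z⟩

theorem exists_jointly_faithful_cons {p : ℕ} [Fact p.Prime] {s : ℕ} {Z : Type*} [CommGroup Z]
    [Finite Z] (hZ : Nat.card Z ∣ p ^ (s + 1)) {φ : Z →* ℂˣ} (hφ : φ ≠ 1) :
    ∃ ψ : Fin (s + 1) → (Z →* ℂˣ), ψ 0 = φ ∧ ∀ z, (∀ i, ψ i z = 1) → z = 1 :=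
  exists_cons_of_ker φ (exists_jointly_faithful s (card_ker_dvd_of_ne_one hZ hφ))

/-! ### Upper bounds from the centre. -/

theorem exists_extension_index_le {p n t : ℕ} [Fact p.Prime] {G : Type*} [Group G] [Finite G]
    (hG : Nat.card G = p ^ n) {A : Subgroup G} {ψ : G → ℂˣ} (hψ : IsCharOn A ψ)
    (hinv : ∀ g : G, ∀ a ∈ A, ⁅g, a⁆ ∈ A ∧ ψ ⁅g, a⁆ = 1) (hA : p ^ t ≤ Nat.card A) :
    ∃ (H : Subgroup G) (χ : G → ℂˣ), A ≤ H ∧ IsCharOn H χ ∧ (∀ a ∈ A, χ a = ψ a) ∧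
      H.index ≤ p ^ ((n - t) / 2) := by
  have hp : p.Prime := Fact.out
  obtain ⟨H, χ, h1, h2, h3, h4⟩ := (IsPGroup.of_card hG).exists_extension_card_le_sq
    (le_top : A ≤ ⊤) hψ fun g _ a ha => hinv g a ha
  refine ⟨H, χ, h1, h2, h3, ?_⟩
  obtain ⟨h, hh, hc⟩ := (Nat.dvd_prime_pow hp).1 (hG ▸ H.card_subgroup_dvd_card)
  have hi := H.card_mul_index
  rw [hc, hG, ← Nat.sub_add_cancel hh, pow_add, mul_comm] at hi
  rw [Nat.eq_of_mul_eq_mul_right (pow_pos hp.pos h) hi]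
  refine Nat.pow_le_pow_right hp.pos ?_
  have h5 : p ^ (n + t) ≤ p ^ (h * 2) := by
    rw [pow_add, pow_mul, ← hc, ← hG, ← Subgroup.card_top (G := G)]
    exact (Nat.mul_le_mul_left _ hA).trans h4
  have := (Nat.pow_le_pow_iff_right hp.one_lt).1 h5
  omega

section centralCharacters

variable {p n s : ℕ} [Fact p.Prime] {G : Type*} [Group G] [Finite G]

theorem exists_extension_of_center (hG : Nat.card G = p ^ n)
    (hZ : Nat.card (Subgroup.center G) = p ^ s) (φ : Subgroup.center G →* ℂˣ) :
    ∃ (H : Subgroup G) (χ : G → ℂˣ), Subgroup.center G ≤ H ∧ IsCharOn H χ ∧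
      (∀ a : Subgroup.center G, χ a = φ a) ∧ H.index ≤ p ^ ((n - s) / 2) := by
  obtain ⟨ψ, hψ, he⟩ := IsCharOn.of_hom φ
  obtain ⟨H, χ, h1, h2, h3, h4⟩ := exists_extension_index_le hG hψ (fun g a ha => by
    have : ⁅g, a⁆ = 1 :=
      commutatorElement_eq_one_iff_mul_comm.2 (Subgroup.mem_center_iff.1 ha g)
    rw [this]
    exact ⟨Subgroup.one_mem _, hψ.map_one⟩) hZ.ge
  exact ⟨H, χ, h1, h2, fun a => (h3 a a.2).trans (he a), h4⟩

/-- If `φ` is trivial on `[x, G]` for some non-central `x`, then it extends to a larger group. -/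
theorem exists_extension_of_center_of_commutator (hG : Nat.card G = p ^ n)
    (hZ : Nat.card (Subgroup.center G) = p ^ s) (φ : Subgroup.center G →* ℂˣ) {x : G}
    (hx : x ∉ Subgroup.center G)
    (hxc : ∀ g, ∃ h : ⁅x, g⁆ ∈ Subgroup.center G, φ ⟨⁅x, g⁆, h⟩ = 1) :
    ∃ (H : Subgroup G) (χ : G → ℂˣ), Subgroup.center G ≤ H ∧ IsCharOn H χ ∧
      (∀ a : Subgroup.center G, χ a = φ a) ∧ H.index ≤ p ^ ((n - (s + 1)) / 2) := by
  obtain ⟨ψ, hψ, he⟩ := IsCharOn.of_hom φ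
  have hcomm : ∀ g : G, ∀ a ∈ Subgroup.center G, ⁅g, a⁆ = 1 := fun g a ha =>
    commutatorElement_eq_one_iff_mul_comm.2 (Subgroup.mem_center_iff.1 ha g)
  obtain ⟨ψ', hψ', hext⟩ := hψ.exists_extension_insert x fun a ha => by
    rw [hcomm x a ha]; exact ⟨Subgroup.one_mem _, hψ.map_one⟩
  set B := Subgroup.closure (insert x (Subgroup.center G : Set G))
  have hZB : Subgroup.center G < B := by
    refine lt_of_le_of_ne (fun a ha => Subgroup.subset_closure (Or.inr ha)) fun h => hx ?_
    rw [h]; exact Subgroup.subset_closure (Or.inl rfl)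
  let K : Subgroup G := φ.ker.map (Subgroup.center G).subtype
  have hKZ : ∀ k ∈ K, k ∈ Subgroup.center G := by
    rintro _ ⟨a, -, rfl⟩; exact a.2
  have hKψ : ∀ k ∈ K, ψ' k = 1 := by
    rintro _ ⟨a, ha, rfl⟩
    exact (hext a a.2).trans ((he a).trans ha)
  have hgK : ∀ g : G, ∀ b ∈ B, ⁅g, b⁆ ∈ K := by
    intro g b hb
    refine commutator_mem_of_forall_generator (fun h _ k hk => ?_) ?_ hb
    · rwa [Subgroup.mem_center_iff.1 (hKZ k hk) h, mul_inv_cancel_right]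
    · rintro t (rfl | ht)
      · obtain ⟨h1, h2⟩ := hxc g
        rw [← commutatorElement_inv]
        exact K.inv_mem ⟨⟨_, h1⟩, h2, rfl⟩
      · rw [hcomm g t ht]; exact K.one_mem
  obtain ⟨H, χ, h1, h2, h3, h4⟩ := exists_extension_index_le (t := s + 1) hG hψ'
    (fun g a ha => ⟨hZB.le (hKZ _ (hgK g a ha)), hKψ _ (hgK g a ha)⟩) (by
      rw [pow_succ', ← hZ]; exact (IsPGroup.of_card hG).mul_card_le_of_lt hZB)
  exact ⟨H, χ, hZB.le.trans h1, h2, fun a =>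
    ((h3 a (hZB.le a.2)).trans (hext a a.2)).trans (he a), h4⟩

theorem rdim_le_of_jointly_faithful (hG : Nat.card G = p ^ n)
    (hZ : Nat.card (Subgroup.center G) = p ^ s) {m : ℕ} {ψ : Fin m → (Subgroup.center G →* ℂˣ)}
    (hψ : ∀ z, (∀ i, ψ i z = 1) → z = 1) : rdim G ≤ m * p ^ ((n - s) / 2) := by
  choose H χ h1 h2 h3 h4 using fun i => exists_extension_of_center hG hZ (ψ i)
  refine ((IsPGroup.of_card hG).rdim_le_sum_index H χ h2 h1 fun z hz h =>
    congrArg Subtype.val (hψ ⟨z, hz⟩ fun i => (h3 i ⟨z, hz⟩).symm.trans (h i))).trans ?_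
  exact (Finset.sum_le_sum fun i _ => h4 i).trans (by simp)

theorem rdim_le_of_card_center (hG : Nat.card G = p ^ n)
    (hZ : Nat.card (Subgroup.center G) = p ^ s) : rdim G ≤ s * p ^ ((n - s) / 2) := by
  obtain ⟨ψ, hψ⟩ := exists_jointly_faithful (p := p) s hZ.dvd
  exact rdim_le_of_jointly_faithful hG hZ hψ

/-- Complete `φ` to a separating family: `φ` extends through `⟨Z, x⟩` and gets the smaller exponent,
the other `s` characters get the general bound. -/
theorem rdim_le_of_card_center_of_commutator (hG : Nat.card G = p ^ n)
    (hZ : Nat.card (Subgroup.center G) = p ^ (s + 1)) {φ : Subgroup.center G →* ℂˣ} (hφ : φ ≠ 1)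
    {x : G} (hx : x ∉ Subgroup.center G)
    (hxc : ∀ g, ∃ h : ⁅x, g⁆ ∈ Subgroup.center G, φ ⟨⁅x, g⁆, h⟩ = 1) :
    rdim G ≤ p ^ ((n - (s + 2)) / 2) + s * p ^ ((n - (s + 1)) / 2) := by
  obtain ⟨ψ, h0, hψ⟩ := exists_jointly_faithful_cons hZ.dvd hφ
  choose H χ h1 h2 h3 h4 using fun i => exists_extension_of_center hG hZ (ψ i)
  obtain ⟨H', χ', h1', h2', h3', h4'⟩ := exists_extension_of_center_of_commutator hG hZ φ hx hxc
  refine ((IsPGroup.of_card hG).rdim_le_sum_index (Fin.cons H' fun i => H i.succ : Fin (s + 1) → _)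
    (Fin.cons χ' fun i => χ i.succ : Fin (s + 1) → _) ?_ ?_ fun z hz h =>
    congrArg Subtype.val (hψ ⟨z, hz⟩ ?_)).trans ?_
  · exact Fin.cases h2' fun i => h2 i.succ
  · exact Fin.cases h1' fun i => h1 i.succ
  · refine Fin.cases ?_ fun i => ?_
    · rw [h0]; exact (h3' ⟨z, hz⟩).symm.trans (h 0)
    · exact (h3 i.succ ⟨z, hz⟩).symm.trans (h i.succ)
  · rw [Fin.sum_univ_succ]
    exact add_le_add h4' ((Finset.sum_le_sum fun i _ => h4 i.succ).trans (by simp))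

end centralCharacters

/-! ### Commutation with an element of the second centre. -/

section commHom

variable {G : Type*} [Group G]

/-- The homomorphism `g ↦ ⁅x, g⁆` for `x` in the second center. -/
def commHom (x : G) (hx : ∀ g, ⁅x, g⁆ ∈ Subgroup.center G) : G →* Subgroup.center G where
  toFun g := ⟨⁅x, g⁆, hx g⟩
  map_one' := by ext; simp
  map_mul' g h := by
    ext
    have h1 := Subgroup.mem_center_iff.1 (hx h) g
    have h2 : ⁅x, g * h⁆ = ⁅x, g⁆ * (g * ⁅x, h⁆ * g⁻¹) := by
      simp only [commutatorElement_def]; group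
    change ⁅x, g * h⁆ = ⁅x, g⁆ * ⁅x, h⁆
    rw [h2, h1, mul_inv_cancel_right]

theorem mem_ker_commHom {x : G} {hx : ∀ g, ⁅x, g⁆ ∈ Subgroup.center G} {g : G} :
    g ∈ (commHom x hx).ker ↔ ⁅x, g⁆ = 1 := by
  rw [MonoidHom.mem_ker, ← Subtype.coe_inj]; rfl

theorem center_lt_ker_commHom {x : G} {hx : ∀ g, ⁅x, g⁆ ∈ Subgroup.center G}
    (h : x ∉ Subgroup.center G) : Subgroup.center G < (commHom x hx).ker := by
  refine lt_of_le_of_ne (fun z hz => mem_ker_commHom.2 ?_) fun he => h ?_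
  · exact commutatorElement_eq_one_iff_mul_comm.2 (Subgroup.mem_center_iff.1 hz x)
  · rw [he]; exact mem_ker_commHom.2 (commutatorElement_self x)

theorem exists_character_of_range_commHom_ne_top [Finite G] {x : G}
    {hx : ∀ g, ⁅x, g⁆ ∈ Subgroup.center G} (h : (commHom x hx).range ≠ ⊤) :
    ∃ φ : Subgroup.center G →* ℂˣ, φ ≠ 1 ∧
      ∀ g, ∃ h : ⁅x, g⁆ ∈ Subgroup.center G, φ ⟨⁅x, g⁆, h⟩ = 1 := by
  obtain ⟨z, hz⟩ : ∃ z, z ∉ (commHom x hx).range := by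
    by_contra! hc
    exact h (eq_top_iff.2 fun z _ => hc z)
  rw [← CommGroup.forall_monoidHom_apply_eq_one_iff ℂ] at hz
  push Not at hz
  obtain ⟨φ, h1, h2⟩ := hz
  refine ⟨φ, ?_, fun g => ⟨hx g, h1 _ ⟨g, rfl⟩⟩⟩
  rintro rfl
  exact h2 rfl

theorem rdim_le_of_range_commHom_ne_top {p n s : ℕ} [Fact p.Prime] [Finite G]
    (hG : Nat.card G = p ^ n)
    (hZ : Nat.card (Subgroup.center G) = p ^ (s + 1)) {x : G} (hxZ : x ∉ Subgroup.center G)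
    {hx : ∀ g, ⁅x, g⁆ ∈ Subgroup.center G} (h : (commHom x hx).range ≠ ⊤) :
    rdim G ≤ p ^ ((n - (s + 2)) / 2) + s * p ^ ((n - (s + 1)) / 2) := by
  obtain ⟨φ, hφ, hc⟩ := exists_character_of_range_commHom_ne_top h
  exact rdim_le_of_card_center_of_commutator hG hZ hφ hxZ hc

/-- If `[x, G]` were the whole centre `Z`, then `|G| = |C(x)| |Z| ≥ p |Z| ^ 2`, because `C(x)`
strictly contains `Z`; the hypothesis on `n` forbids this. -/
theorem rdim_le_of_lt_two_mul_card_center {p n s : ℕ} [Fact p.Prime] [Finite G]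
    (hG : Nat.card G = p ^ n)
    (hZ : Nat.card (Subgroup.center G) = p ^ (s + 1)) (h1 : s + 1 < n) (h2 : n < 2 * s + 3) :
    rdim G ≤ p ^ ((n - (s + 2)) / 2) + s * p ^ ((n - (s + 1)) / 2) := by
  have hp : p.Prime := Fact.out
  obtain ⟨x, hxZ, -, hx⟩ := (IsPGroup.of_card hG).exists_commutator_mem_of_ne_top
    (Subgroup.center G) fun h => by
      rw [h, Subgroup.card_top, hG] at hZ
      exact h1.ne' (Nat.pow_right_injective hp.two_le hZ)
  refine rdim_le_of_range_commHom_ne_top hG hZ hxZ (hx := hx) fun htop => ?_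
  have h3 := (IsPGroup.of_card hG).mul_card_le_of_lt (center_lt_ker_commHom (hx := hx) hxZ)
  have h4 := (commHom x hx).ker.card_mul_index
  rw [Subgroup.index_ker, htop, Subgroup.card_top, hG, hZ] at h4
  rw [hZ, ← pow_succ'] at h3
  have h5 : p ^ (2 * s + 3) ≤ p ^ n := by
    calc p ^ (2 * s + 3) = p ^ (s + 1 + 1) * p ^ (s + 1) := by rw [← pow_add]; congr 1; ring
      _ ≤ _ := Nat.mul_le_mul_right _ h3
      _ = _ := h4
  exact absurd ((Nat.pow_le_pow_iff_right hp.one_lt).1 h5) (by omega)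

end commHom

/-! ### Groups of order 128 with centre of order 8. -/

section order128

variable {G : Type*} [Group G]

theorem index_ker_commHom_of_surjective (hG : Nat.card G = 2 ^ 7)
    (hZ : Nat.card (Subgroup.center G) = 2 ^ 3) {x : G}
    {hx : ∀ g, ⁅x, g⁆ ∈ Subgroup.center G} (h : (commHom x hx).range = ⊤) :
    (commHom x hx).ker.index = 8 ∧ Nat.card (commHom x hx).ker = 16 := by
  have h4 := (commHom x hx).ker.card_mul_index
  have h5 := Subgroup.index_ker (commHom x hx)
  rw [h, Subgroup.card_top, hZ] at h5
  rw [h5, hG] at h4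
  exact ⟨h5, by omega⟩

/-- The centralizer of `x` has order 16, so the centre has index two in it. -/
theorem mul_mem_center_iff_of_mem_ker_commHom (hG : Nat.card G = 2 ^ 7)
    (hZ : Nat.card (Subgroup.center G) = 2 ^ 3) {x : G} (hxZ : x ∉ Subgroup.center G)
    {hx : ∀ g, ⁅x, g⁆ ∈ Subgroup.center G} (h : (commHom x hx).range = ⊤) {g g' : G}
    (hg : g ∈ (commHom x hx).ker) (hg' : g' ∈ (commHom x hx).ker) :
    g * g' ∈ Subgroup.center G ↔ (g ∈ Subgroup.center G ↔ g' ∈ Subgroup.center G) := by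
  have h2 : (Subgroup.center G).relIndex (commHom x hx).ker = 2 := by
    have := Subgroup.relIndex_mul_relIndex _ _ _ bot_le (center_lt_ker_commHom (hx := hx) hxZ).le
    rw [Subgroup.relIndex_bot_left, Subgroup.relIndex_bot_left,
      (index_ker_commHom_of_surjective hG hZ h).2, hZ] at this
    omega
  exact Subgroup.mul_mem_iff_of_index_two h2 (a := ⟨g, hg⟩) (b := ⟨g', hg'⟩)

theorem mul_mem_iff_of_relIndex_two {H K : Subgroup G} (h : H.relIndex K = 2) {a b : G}
    (ha : a ∈ K) (hb : b ∈ K) : a * b ∈ H ↔ (a ∈ H ↔ b ∈ H) :=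
  Subgroup.mul_mem_iff_of_index_two (H := H.subgroupOf K) h (a := ⟨a, ha⟩) (b := ⟨b, hb⟩)

theorem relIndex_eq_two_of_mul_mem_iff {H K : Subgroup G} {y : G} (hy : y ∈ K) (hyH : y ∉ H)
    (hm : ∀ a ∈ K, a * y ∈ H ↔ (a ∈ H ↔ y ∈ H)) : H.relIndex K = 2 := by
  refine Subgroup.index_eq_two_iff.2 ⟨⟨y, hy⟩, fun b => ?_⟩
  have := hm b b.2
  by_cases hb : (b : G) ∈ H
  · exact Or.inr ⟨hb, fun h => hyH ((this.1 h).1 hb)⟩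
  · exact Or.inl ⟨this.2 (iff_of_false hb hyH), hb⟩

/-- Let `C` be the centralizer of `x`. Commutators lie in `C` and `C` lies in the second centre, so
commutation induces an alternating form on `G / C`, of order 8, with values in `C / Z`, of order 2.
Such forms have even rank, so the radical is nontrivial; `w` represents a nonzero radical element.
-/
theorem exists_second_center_not_mem_ker_commHom (hG : Nat.card G = 2 ^ 7)
    (hZ : Nat.card (Subgroup.center G) = 2 ^ 3) {x : G} (hxZ : x ∉ Subgroup.center G)
    {hx : ∀ g, ⁅x, g⁆ ∈ Subgroup.center G} (htop : (commHom x hx).range = ⊤) :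
    ∃ w, w ∉ (commHom x hx).ker ∧ ∀ g, ⁅w, g⁆ ∈ Subgroup.center G := by
  set C := (commHom x hx).ker with hC
  have hCi := (index_ker_commHom_of_surjective hG hZ htop).1
  by_cases hcl : ∀ y t : G, ⁅y, t⁆ ∈ Subgroup.center G
  · obtain ⟨w, hw⟩ : ∃ w, w ∉ C := by
      by_contra! hc
      rw [(eq_top_iff.2 fun z _ => hc z : (commHom x hx).ker = ⊤), Subgroup.index_top] at hCi
      omega
    exact ⟨w, hw, hcl w⟩
  push Not at hcl
  obtain ⟨y, t, hyt⟩ := hcl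
  have hmulC : ∀ g ∈ C, ∀ g' ∈ C, g * g' ∈ Subgroup.center G ↔
      (g ∈ Subgroup.center G ↔ g' ∈ Subgroup.center G) := fun g hg g' hg' =>
    mul_mem_center_iff_of_mem_ker_commHom hG hZ hxZ htop hg hg'
  have hcommC : ∀ a b : G, ⁅a, b⁆ ∈ C := fun a b => by
    rw [hC, MonoidHom.mem_ker, map_commutatorElement, commutatorElement_eq_one_iff_mul_comm, mul_comm]
  have hxC : x ∈ C := mem_ker_commHom.2 (commutatorElement_self x)
  have hC2 : ∀ c ∈ C, ∀ g : G, ⁅g, c⁆ ∈ Subgroup.center G := by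
    intro c hc g
    by_cases hcz : c ∈ Subgroup.center G
    · rw [commutatorElement_eq_one_iff_mul_comm.2 (Subgroup.mem_center_iff.1 hcz g)]
      exact Subgroup.one_mem _
    · have h1 := (hmulC x hxC c hc).2 (iff_of_false hxZ hcz)
      have h2 : c = x⁻¹ * (x * c) := by group
      have h3 := Subgroup.mem_center_iff.1 h1 g⁻¹
      have h4 : ⁅g, c⁆ = g * x⁻¹ * ((x * c) * g⁻¹) * (x * c)⁻¹ * x := by
        simp only [commutatorElement_def]; group
      have h5 : ⁅g, c⁆ = x⁻¹ * ⁅x, g⁆ * x := by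
        rw [h4, ← h3]; simp only [commutatorElement_def]; group
      rw [h5, Subgroup.mem_center_iff.1 (hx g) x⁻¹, inv_mul_cancel_right]
      exact hx g
  have hmul : ∀ u h k : G, ⁅u, h * k⁆ ∈ Subgroup.center G ↔
      (⁅u, h⁆ ∈ Subgroup.center G ↔ ⁅u, k⁆ ∈ Subgroup.center G) := by
    intro u h k
    have h1 : ⁅u, h * k⁆ = ⁅u, h⁆ * (⁅h, ⁅u, k⁆⁆ * ⁅u, k⁆) := by
      simp only [commutatorElement_def]; group
    have h2 := hC2 _ (hcommC u k) h
    have h3 : ⁅h, ⁅u, k⁆⁆ * ⁅u, k⁆ ∈ Subgroup.center G ↔ ⁅u, k⁆ ∈ Subgroup.center G :=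
      Subgroup.mul_mem_cancel_left _ h2
    rw [h1, hmulC _ (hcommC u h) _ (C.mul_mem (hcommC _ _) (hcommC u k)), h3]
  have hsymm : ∀ u v : G, ⁅u, v⁆ ∈ Subgroup.center G ↔ ⁅v, u⁆ ∈ Subgroup.center G := fun u v => by
    rw [← commutatorElement_inv, Subgroup.inv_mem_iff]
  -- `D u` is the orthogonal of `u`. As `y`, `t` span a hyperbolic plane, `D y ⊓ D t` is its
  -- complement, and it contains `C` with index 2.
  let D : G → Subgroup G := fun u =>
    { carrier := {h | ⁅u, h⁆ ∈ Subgroup.center G}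
      one_mem' := by simp
      mul_mem' := fun {h k} hh hk => (hmul u h k).2 (iff_of_true hh hk)
      inv_mem' := fun {h} hh => ((hmul u h h⁻¹).1 (by simp)).1 hh }
  have hD : ∀ u h, h ∈ D u ↔ ⁅u, h⁆ ∈ Subgroup.center G := fun _ _ => Iff.rfl
  have hself : ∀ u, u ∈ D u := fun u => (hD u u).2 (by simp)
  have hi1 : (D y).relIndex ⊤ = 2 :=
    relIndex_eq_two_of_mul_mem_iff (Subgroup.mem_top t) hyt fun a _ => hmul y a t
  have hi2 : (D y ⊓ D t).relIndex (D y) = 2 := by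
    refine relIndex_eq_two_of_mul_mem_iff (hself y) (fun h => hyt ((hsymm _ _).1 h.2))
      fun a ha => ?_
    rw [Subgroup.mem_inf, Subgroup.mem_inf, Subgroup.mem_inf]
    have := hmul t a y
    have h1 := (D y).mul_mem ha (hself y)
    simp only [h1, ha, hself y, true_and]
    exact this
  have hCD : C ≤ D y ⊓ D t := fun c hc => ⟨hC2 c hc y, hC2 c hc t⟩
  have hi3 : C.relIndex (D y ⊓ D t) = 2 := by
    have h1 := Subgroup.relIndex_mul_relIndex _ _ _ (inf_le_left : D y ⊓ D t ≤ D y) le_top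
    have h2 := Subgroup.relIndex_mul_relIndex _ _ _ hCD le_top
    rw [hi1, hi2] at h1
    rw [← h1, Subgroup.relIndex_top_right, hCi] at h2
    omega
  obtain ⟨w, hwD, hwC⟩ : ∃ w ∈ D y ⊓ D t, w ∉ C := by
    by_contra! hc
    rw [Subgroup.relIndex_eq_one.2 hc] at hi3
    omega
  refine ⟨w, hwC, fun g => ?_⟩
  have hwd : ∀ d ∈ D y ⊓ D t, ⁅w, d⁆ ∈ Subgroup.center G := by
    intro d hd
    by_cases hdC : d ∈ C
    · exact hC2 d hdC w
    · have := hC2 _ ((mul_mem_iff_of_relIndex_two hi3 hwD hd).2 (iff_of_false hwC hdC)) w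
      exact ((hmul w w d).1 this).1 (hself w)
  have hwy : ⁅w, y⁆ ∈ Subgroup.center G := (hsymm _ _).1 hwD.1
  have hwt : ⁅w, t⁆ ∈ Subgroup.center G := (hsymm _ _).1 hwD.2
  have hDy : ∀ g ∈ D y, ⁅w, g⁆ ∈ Subgroup.center G := by
    intro g hg
    by_cases hgt : g ∈ D t
    · exact hwd g ⟨hg, hgt⟩
    · have h1 := hwd (g * y) ⟨(D y).mul_mem hg (hself y),
        (hmul t g y).2 (iff_of_false hgt (fun h => hyt ((hsymm _ _).1 h)))⟩
      exact ((hmul w g y).1 h1).2 hwy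
  by_cases hgy : g ∈ D y
  · exact hDy g hgy
  · have h1 := hDy (g * t) ((hmul y g t).2 (iff_of_false hgy hyt))
    exact ((hmul w g t).1 h1).2 hwt

end order128

/-- For `g`, `h` with `B x g`, `B x h` spanning a plane of `F₂³`, the hypothesis puts `B g h`
outside the plane, so the functional cutting out the plane takes the value 1 on it. Adding this over
the seven planes gives 7 = 1 on one side, while on the other every coordinate of `B a b`, `B a c`,
`B b c` occurs an even number of times. -/
theorem no_anisotropic_alternating_map {G : Type*} [Mul G] (B : G → G → Fin 3 → ZMod 2)
    (hl : ∀ u v w, B (u * v) w = B u w + B v w) (hr : ∀ u v w, B u (v * w) = B u v + B u w)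
    (hself : ∀ u, B u u = 0) {x : G} (hx : ∀ z, ∃ g, B x g = z)
    (h : ∀ g h, B x g ≠ 0 → B x h ≠ 0 → B x g + B x h ≠ 0 →
      ∀ i j : ZMod 2, B g h + i • B x h + j • B x g ≠ 0) : False := by
  obtain ⟨a, ha⟩ := hx ![1, 0, 0]
  obtain ⟨b, hb⟩ := hx ![0, 1, 0]
  obtain ⟨c, hc⟩ := hx ![0, 0, 1]
  have hba : B b a = B a b := by
    have h1 := hself (a * b)
    rw [hl, hr, hr, hself, hself, zero_add, add_zero] at h1
    rw [eq_neg_of_add_eq_zero_right h1]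
    ext i; exact CharTwo.neg_eq _
  have hcb : B c b = B b c := by
    have h1 := hself (b * c)
    rw [hl, hr, hr, hself, hself, zero_add, add_zero] at h1
    rw [eq_neg_of_add_eq_zero_right h1]
    ext i; exact CharTwo.neg_eq _
  have hca : B c a = B a c := by
    have h1 := hself (a * c)
    rw [hl, hr, hr, hself, hself, zero_add, add_zero] at h1
    rw [eq_neg_of_add_eq_zero_right h1]
    ext i; exact CharTwo.neg_eq _
  obtain ⟨p, hp⟩ : ∃ p, p = B a b := ⟨_, rfl⟩
  obtain ⟨q, hq⟩ : ∃ q, q = B a c := ⟨_, rfl⟩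
  obtain ⟨r, hr'⟩ : ∃ r, r = B b c := ⟨_, rfl⟩
  have one : ∀ z : ZMod 2, z ≠ 0 → z = 1 := by decide
  have hpr : B b (a * c) = p + r := by rw [hr, hba, hp, hr']
  have hpq : B a (b * c) = p + q := by rw [hr, hp, hq]
  have hqr : B c (a * b) = q + r := by rw [hr, hca, hcb, hq, hr']
  have hpqr : B (a * b) (a * c) = p + q + r := by
    rw [hl, hr, hr, hself, hba, hp, hq, hr']; abel
  have e1 : p 2 = 1 := one _ fun h0 => by
    refine h a b ?_ ?_ ?_ (p 1) (p 0) ?_ <;> simp only [ha, hb]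
    · decide
    · decide
    · decide
    · rw [← hp]; exact (by decide : ∀ v : Fin 3 → ZMod 2, v 2 = 0 →
        v + v 1 • ![0, 1, 0] + v 0 • ![1, 0, 0] = 0) _ h0
  have e2 : q 1 = 1 := one _ fun h0 => by
    refine h a c ?_ ?_ ?_ (q 2) (q 0) ?_ <;> simp only [ha, hc]
    · decide
    · decide
    · decide
    · rw [← hq]; exact (by decide : ∀ v : Fin 3 → ZMod 2, v 1 = 0 →
        v + v 2 • ![0, 0, 1] + v 0 • ![1, 0, 0] = 0) _ h0
  have e3 : r 0 = 1 := one _ fun h0 => by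
    refine h b c ?_ ?_ ?_ (r 2) (r 1) ?_ <;> simp only [hb, hc]
    · decide
    · decide
    · decide
    · rw [← hr']; exact (by decide : ∀ v : Fin 3 → ZMod 2, v 0 = 0 →
        v + v 2 • ![0, 0, 1] + v 1 • ![0, 1, 0] = 0) _ h0
  have e4 : (p + q) 1 + (p + q) 2 = 1 := one _ fun h0 => by
    refine h a (b * c) ?_ ?_ ?_ ((p + q) 1) ((p + q) 0) ?_ <;> simp only [ha, hb, hc, hr x]
    · decide
    · decide
    · decide
    · rw [hpq]; exact (by decide : ∀ v : Fin 3 → ZMod 2, v 1 + v 2 = 0 →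
        v + v 1 • (![0, 1, 0] + ![0, 0, 1]) + v 0 • ![1, 0, 0] = 0) _ h0
  have e5 : (p + r) 0 + (p + r) 2 = 1 := one _ fun h0 => by
    refine h b (a * c) ?_ ?_ ?_ ((p + r) 0) ((p + r) 1) ?_ <;> simp only [ha, hb, hc, hr x]
    · decide
    · decide
    · decide
    · rw [hpr]; exact (by decide : ∀ v : Fin 3 → ZMod 2, v 0 + v 2 = 0 →
        v + v 0 • (![1, 0, 0] + ![0, 0, 1]) + v 1 • ![0, 1, 0] = 0) _ h0
  have e6 : (q + r) 0 + (q + r) 1 = 1 := one _ fun h0 => by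
    refine h c (a * b) ?_ ?_ ?_ ((q + r) 0) ((q + r) 2) ?_ <;> simp only [ha, hb, hc, hr x]
    · decide
    · decide
    · decide
    · rw [hqr]; exact (by decide : ∀ v : Fin 3 → ZMod 2, v 0 + v 1 = 0 →
        v + v 0 • (![1, 0, 0] + ![0, 1, 0]) + v 2 • ![0, 0, 1] = 0) _ h0
  have e7 : (p + q + r) 0 + ((p + q + r) 1 + (p + q + r) 2) = 1 := one _ fun h0 => by
    refine h (a * b) (a * c) ?_ ?_ ?_ ((p + q + r) 2) ((p + q + r) 1) ?_ <;> simp only [ha, hb, hc, hr x]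
    · decide
    · decide
    · decide
    · rw [hpqr]; exact (by decide : ∀ v : Fin 3 → ZMod 2, v 0 + (v 1 + v 2) = 0 →
        v + v 2 • (![1, 0, 0] + ![0, 0, 1]) + v 1 • (![1, 0, 0] + ![0, 1, 0]) = 0) _ h0
  simp only [Pi.add_apply] at e4 e5 e6 e7
  have t : (2 : ZMod 2) = 0 := rfl
  exact one_ne_zero (α := ZMod 2) (by
    linear_combination - e1 - e2 - e3 - e4 - e5 - e6 - e7 +
      (p 0 + p 1 + 2 * p 2 + q 0 + 2 * q 1 + q 2 + 2 * r 0 + r 1 + r 2 - 3) * t)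

theorem exists_addEquiv_fin_zmod_two {Z : Type*} [CommGroup Z] [Finite Z] {s : ℕ}
    (hZ : Nat.card Z = 2 ^ s) (h2 : ∀ z : Z, z ^ 2 = 1) :
    Nonempty (Additive Z ≃+ (Fin s → ZMod 2)) := by
  let _ : Module (ZMod 2) (Additive Z) := AddCommGroup.zmodModule (n := 2) fun z => h2 z.toMul
  have h1 := Module.natCard_eq_pow_finrank (K := ZMod 2) (V := Additive Z)
  rw [Nat.card_zmod, Nat.card_congr Additive.toMul, hZ] at h1
  have h3 := Nat.pow_right_injective le_rfl h1
  exact ⟨(LinearEquiv.ofFinrankEq (Additive Z) (Fin s → ZMod 2)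
    (by rw [← h3, Module.finrank_fin_fun])).toAddEquiv⟩

theorem exists_range_commHom_ne_top {G : Type*} [Group G] [Finite G] (hG : Nat.card G = 2 ^ 7)
    (hZ : Nat.card (Subgroup.center G) = 2 ^ 3) (h2 : ∀ z : Subgroup.center G, z ^ 2 = 1) :
    ∃ x : G, ∃ hx : ∀ g, ⁅x, g⁆ ∈ Subgroup.center G,
      x ∉ Subgroup.center G ∧ (commHom x hx).range ≠ ⊤ := by
  by_contra! hcon
  obtain ⟨x, hxZ, -, hx⟩ := (IsPGroup.of_card hG).exists_commutator_mem_of_ne_top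
    (Subgroup.center G) fun h => by
      rw [h, Subgroup.card_top, hG] at hZ
      norm_num at hZ
  have hker : ∀ (x : G) (hx : ∀ g, ⁅x, g⁆ ∈ Subgroup.center G), x ∉ Subgroup.center G →
      ∀ g, ⁅x, g⁆ = 1 → g ∉ Subgroup.center G → x * g ∈ Subgroup.center G := by
    intro x hx hxZ g hg hgZ
    exact (mul_mem_center_iff_of_mem_ker_commHom hG hZ hxZ (hcon x hx hxZ)
      (mem_ker_commHom.2 (commutatorElement_self x)) (mem_ker_commHom.2 hg)).2
      (iff_of_false hxZ hgZ)
  have hcommC : ∀ (x : G) (hx : ∀ g, ⁅x, g⁆ ∈ Subgroup.center G), ∀ a b : G, ⁅x, ⁅a, b⁆⁆ = 1 := by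
    intro x hx a b
    rw [← mem_ker_commHom (hx := hx), MonoidHom.mem_ker, map_commutatorElement,
      commutatorElement_eq_one_iff_mul_comm, mul_comm]
  obtain ⟨w, hwC, hw⟩ := exists_second_center_not_mem_ker_commHom hG hZ hxZ (hcon x hx hxZ)
  have hwZ : w ∉ Subgroup.center G := fun h => hwC (center_lt_ker_commHom hxZ |>.le h)
  -- Both `x` and `w` centralize commutators. A noncentral one would lie in the nontrivial coset of
  -- `Z` in both centralizers, forcing `w ∈ Zx`, so that `w` commutes with `x`.
  have hcl : ∀ a b : G, ⁅a, b⁆ ∈ Subgroup.center G := by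
    intro a b
    by_contra hab
    have h1 := hker x hx hxZ _ (hcommC x hx a b) hab
    have h3 := hker w hw hwZ _ (hcommC w hw a b) hab
    refine hwC ?_
    have h4 : w = (x * ⁅a, b⁆ * (w * ⁅a, b⁆)⁻¹)⁻¹ * x := by group
    rw [h4]
    refine Subgroup.mul_mem _ (Subgroup.inv_mem _ (center_lt_ker_commHom hxZ |>.le
      (Subgroup.mul_mem _ h1 (Subgroup.inv_mem _ h3)))) ?_
    exact mem_ker_commHom.2 (commutatorElement_self x)
  obtain ⟨e⟩ := exists_addEquiv_fin_zmod_two hZ h2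
  let B : G → G → Fin 3 → ZMod 2 := fun u v => e (Additive.ofMul (commHom u (hcl u) v))
  have hr : ∀ u v w, B u (v * w) = B u v + B u w := by
    intro u v w
    simp only [B, map_mul, ofMul_mul, map_add]
  have hsw : ∀ u v, B u v = - B v u := by
    intro u v
    simp only [B, ← map_neg, ← ofMul_inv]
    congr 2
    ext
    exact (commutatorElement_inv v u).symm
  have hself : ∀ u, B u u = 0 := by
    intro u
    have : commHom u (hcl u) u = 1 := by ext; exact commutatorElement_self u
    simp only [B, this, ofMul_one, map_zero]
  have hBc : ∀ u v, u ∈ Subgroup.center G → B v u = 0 := by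
    intro u v hu
    have : commHom v (hcl v) u = 1 := by
      ext; exact commutatorElement_eq_one_iff_mul_comm.2 (Subgroup.mem_center_iff.1 hu v)
    simp only [B, this, ofMul_one, map_zero]
  have hl : ∀ u v w, B (u * v) w = B u w + B v w := by
    intro u v w
    rw [hsw, hr, neg_add, ← hsw, ← hsw]
  have hB0 : ∀ u v, B u v = 0 → u ∈ Subgroup.center G ∨ v ∈ Subgroup.center G ∨
      u * v ∈ Subgroup.center G := by
    intro u v huv
    by_contra! hc
    have h1 : commHom u (hcl u) v = 1 := by
      have := (map_eq_zero_iff e e.injective).1 huv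
      exact this
    exact hc.2.2 (hker u (hcl u) hc.1 v (congrArg Subtype.val h1) hc.2.1)
  refine no_anisotropic_alternating_map B hl hr hself (x := x) (fun z => ?_) ?_
  · obtain ⟨g, hg⟩ : (e.symm z).toMul ∈ (commHom x (hcl x)).range := by
      rw [hcon x (hcl x) hxZ]; trivial
    exact ⟨g, by simp only [B, hg, ofMul_toMul, AddEquiv.apply_symm_apply]⟩
  · intro g h hg hh hgh i j h0
    -- The forbidden expression is `B` at `x ^ i * g` and `x ^ j * h`. Its vanishing makes one of
    -- these or their product central, hence `B x` vanishes at `g`, `h` or `g * h`.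
    have hpow : ∀ (k : ZMod 2) (u v : G), B (x ^ k.val * u) v = B u v + k • B x v := by
      intro k u v
      obtain rfl | rfl : k = 0 ∨ k = 1 := by revert k; decide
      · simp
      · simp [ZMod.val_one, hl, add_comm]
    have hxpow : ∀ (k : ZMod 2) (u : G), B x (x ^ k.val * u) = B x u := by
      intro k u
      obtain rfl | rfl : k = 0 ∨ k = 1 := by revert k; decide
      · simp
      · simp [ZMod.val_one, hr, hself]
    have hsw' : ∀ u v, B u v = B v u := fun u v => by
      rw [hsw]; ext; exact CharTwo.neg_eq _
    have h3 : B (x ^ i.val * g) (x ^ j.val * h) = 0 := by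
      rw [hpow, hxpow, hsw' g, hpow, hsw' h g, ← h0]
      abel
    rcases hB0 _ _ h3 with h4 | h4 | h4
    · exact hg (by rw [← hxpow i g]; exact hBc _ _ h4)
    · exact hh (by rw [← hxpow j h]; exact hBc _ _ h4)
    · exact hgh (by rw [← hxpow i g, ← hxpow j h, ← hr]; exact hBc _ _ h4)

/-! ### The upper bounds on `rdim`. -/

theorem IsPGroup.exists_card_center {p n : ℕ} [Fact p.Prime] {G : Type*} [Group G]
    (hG : Nat.card G = p ^ n) (hn : 1 ≤ n) :
    ∃ s, 1 ≤ s ∧ s ≤ n ∧ Nat.card (Subgroup.center G) = p ^ s := by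
  have hp : p.Prime := Fact.out
  obtain ⟨s, hs, hc⟩ := IsPGroup.card_center_eq_prime_pow hG hn
  refine ⟨s, hs, ?_, hc⟩
  have := (Subgroup.center G).card_subgroup_dvd_card
  rw [hc, hG] at this
  exact (Nat.pow_dvd_pow_iff_le_right hp.one_lt).1 this

theorem finite_of_card_eq_prime_pow {p n : ℕ} (hp : p.Prime) {G : Type*}
    (hG : Nat.card G = p ^ n) : Finite G :=
  Nat.finite_of_card_ne_zero (hG ▸ (pow_pos hp.pos n).ne')

theorem rdim_le_fMax {p n : ℕ} (hp : p.Prime) {G : Type*} [Group G]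
    (hG : Nat.card G = p ^ n) (hn : 1 ≤ n) : rdim G ≤ fMax p n := by
  have := Fact.mk hp
  have := finite_of_card_eq_prime_pow hp hG
  obtain ⟨s, h1, h2, hc⟩ := IsPGroup.exists_card_center hG hn
  exact (rdim_le_of_card_center hG hc).trans
    (Finset.le_sup (f := fun r => r * p ^ ((n - r) / 2)) (Finset.mem_Icc.2 ⟨h1, h2⟩))

theorem rdim_le_add_one_of_card_eq_pow_four {p : ℕ} (hp : p.Prime) (hodd : Odd p) {G : Type*}
    [Group G] (hG : Nat.card G = p ^ 4) : rdim G ≤ p + 1 := by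
  have := Fact.mk hp
  have := finite_of_card_eq_prime_pow hp hG
  have hp3 : 3 ≤ p := by
    have := hp.two_le
    obtain ⟨k, hk⟩ := hodd
    omega
  obtain ⟨s, h1, h2, hc⟩ := IsPGroup.exists_card_center hG (by norm_num)
  have hle := rdim_le_of_card_center hG hc
  interval_cases s
  · norm_num at hle; omega
  -- Only a centre of order `p ^ 2` needs the refined bound: the general one gives `2 * p`.
  · have := rdim_le_of_lt_two_mul_card_center (s := 1) hG hc (by norm_num) (by norm_num)
    norm_num at this; omega
  · norm_num at hle; omega
  · norm_num at hle; omega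

theorem rdim_le_five_of_card_eq {G : Type*} [Group G] (hG : Nat.card G = 2 ^ 5) :
    rdim G ≤ 5 := by
  have := finite_of_card_eq_prime_pow Nat.prime_two hG
  obtain ⟨s, h1, h2, hc⟩ := IsPGroup.exists_card_center hG (by norm_num)
  have hle := rdim_le_of_card_center hG hc
  interval_cases s
  · norm_num at hle; omega
  · norm_num at hle; omega
  -- For a centre of order 8 the general bound is 6; the refined one is `1 + 2 * 2`.
  · have := rdim_le_of_lt_two_mul_card_center (s := 2) hG hc (by norm_num) (by norm_num)
    norm_num at this; omega
  · norm_num at hle; omega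
  · norm_num at hle; omega

/-- A character with `φ (a ^ 2) ≠ 1` has image of order at least 4, so its kernel has order at most
2 and one more character suffices. -/
theorem exists_pair_jointly_faithful {Z : Type*} [CommGroup Z] [Finite Z]
    (hZ : Nat.card Z = 2 ^ 3) {a : Z} (ha : a ^ 2 ≠ 1) :
    ∃ ψ : Fin 2 → (Z →* ℂˣ), ∀ z, (∀ i, ψ i z = 1) → z = 1 := by
  obtain ⟨φ, hφ⟩ := CommGroup.exists_apply_ne_one_of_hasEnoughRootsOfUnity Z ℂ ha
  have h1 := φ.ker.card_mul_index
  rw [Subgroup.index_ker, hZ] at h1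
  have h2 : ¬ Nat.card φ.range ∣ 2 := fun hd => by
    obtain ⟨k, hk⟩ := hd
    have h3 : (⟨φ a, a, rfl⟩ : φ.range) ^ Nat.card φ.range = 1 := pow_card_eq_one'
    have h4 : φ a ^ Nat.card φ.range = 1 := congrArg Subtype.val h3
    rw [map_pow, hk, pow_mul, h4, one_pow] at hφ
    exact hφ rfl
  have h3 : Nat.card φ.ker ∣ 2 ^ 1 := by
    have hd : Nat.card φ.range ∣ 2 ^ 3 := ⟨_, by rw [mul_comm]; exact h1.symm⟩
    obtain ⟨j, hj, hj'⟩ := (Nat.dvd_prime_pow Nat.prime_two).1 hd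
    rw [hj'] at h1 h2
    interval_cases j
    · norm_num at h2
    · norm_num at h2
    · exact ⟨1, by omega⟩
    · exact ⟨2, by omega⟩
  obtain ⟨ψ, -, hψ⟩ := exists_cons_of_ker φ (exists_jointly_faithful (p := 2) 1 h3)
  exact ⟨ψ, hψ⟩

theorem rdim_le_ten_of_card_eq {G : Type*} [Group G] (hG : Nat.card G = 2 ^ 7) :
    rdim G ≤ 10 := by
  have := finite_of_card_eq_prime_pow Nat.prime_two hG
  obtain ⟨s, h1, h2, hc⟩ := IsPGroup.exists_card_center hG (by norm_num)
  have hle := rdim_le_of_card_center hG hc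
  by_cases hs : s = 3
  · subst hs
    by_cases hexp : ∀ z : Subgroup.center G, z ^ 2 = 1
    · obtain ⟨x, hx, hxZ, hr⟩ := exists_range_commHom_ne_top hG hc hexp
      have := rdim_le_of_range_commHom_ne_top (s := 2) hG hc hxZ hr
      norm_num at this; omega
    · push Not at hexp
      obtain ⟨a, ha⟩ := hexp
      obtain ⟨ψ, hψ⟩ := exists_pair_jointly_faithful hc ha
      have := rdim_le_of_jointly_faithful hG hc hψ
      norm_num at this; omega
  · interval_cases s <;> norm_num at hle <;> omega

/-! ### Weights of a finite abelian group. -/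

section weights

open Module

variable {W : Type*} [AddCommGroup W] [Module ℂ W] {M : Type*} [CommGroup M]

/-- The simultaneous eigenspace of weight `χ`. -/
def weightSpace (τ : Representation ℂ M W) (χ : M → ℂ) : Submodule ℂ W :=
  ⨅ m, End.eigenspace (τ m) (χ m)

theorem mem_weightSpace {τ : Representation ℂ M W} {χ : M → ℂ} {w : W} :
    w ∈ weightSpace τ χ ↔ ∀ m, τ m w = χ m • w := by
  simp [weightSpace]

theorem weightSpace_eq_iInf_maxGenEigenspace [Finite M] [FiniteDimensional ℂ W]
    (τ : Representation ℂ M W) (χ : M → ℂ) :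
    weightSpace τ χ = ⨅ m, End.maxGenEigenspace (τ m) (χ m) := by
  refine iInf_congr fun m => ?_
  have hc : (Nat.card M : ℂ) ≠ 0 := Nat.cast_ne_zero.2 Nat.card_pos.ne'
  have hs : End.IsSemisimple (τ m) := by
    refine End.isSemisimple_of_squarefree_aeval_eq_zero
      (Polynomial.X_pow_sub_one_separable_iff.2 hc).squarefree ?_
    rw [map_sub, map_pow, Polynomial.aeval_X, map_one, ← map_pow, pow_card_eq_one', map_one, sub_self]
  exact ((End.isFinitelySemisimple_iff_isSemisimple.2 hs).maxGenEigenspace_eq_eigenspace _).symm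

theorem iSupIndep_weightSpace [Finite M] [FiniteDimensional ℂ W] (τ : Representation ℂ M W) :
    iSupIndep (weightSpace τ) := by
  rw [funext (weightSpace_eq_iInf_maxGenEigenspace τ)]
  refine End.independent_iInf_maxGenEigenspace_of_forall_mapsTo _ fun i j φ =>
    End.mapsTo_maxGenEigenspace_of_comm ?_ φ
  rw [commute_iff_eq, ← map_mul, ← map_mul, mul_comm]

theorem iSup_weightSpace_eq_top [Finite M] [FiniteDimensional ℂ W] (τ : Representation ℂ M W) :
    ⨆ χ, weightSpace τ χ = ⊤ := by
  rw [iSup_congr (weightSpace_eq_iInf_maxGenEigenspace τ)]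
  refine End.iSup_iInf_maxGenEigenspace_eq_top_of_iSup_maxGenEigenspace_eq_top_of_commute _
    (fun i j _ => ?_) fun m => End.iSup_maxGenEigenspace_eq_top (τ m)
  change Commute _ _
  rw [commute_iff_eq, ← map_mul, ← map_mul, mul_comm]

/-- The weights that occur in `τ`. -/
def weights (τ : Representation ℂ M W) : Set (M → ℂ) := {χ | weightSpace τ χ ≠ ⊥}

theorem finite_weights [Finite M] [FiniteDimensional ℂ W] (τ : Representation ℂ M W) :
    (weights τ).Finite :=
  WellFoundedGT.finite_ne_bot_of_iSupIndep (iSupIndep_weightSpace τ)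

theorem weights_map_mul {τ : Representation ℂ M W} {χ : M → ℂ} (hχ : χ ∈ weights τ) (a b : M) :
    χ (a * b) = χ a * χ b := by
  obtain ⟨w, hw, hw0⟩ := Submodule.exists_mem_ne_zero_of_ne_bot hχ
  have hw := mem_weightSpace.1 hw
  have h1 : τ (a * b) w = (χ a * χ b) • w := by
    rw [map_mul, End.mul_apply, hw b, map_smul, hw a, smul_smul, mul_comm]
  rw [hw] at h1
  exact smul_left_injective ℂ hw0 h1

theorem weights_map_one {τ : Representation ℂ M W} {χ : M → ℂ} (hχ : χ ∈ weights τ) :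
    χ 1 = 1 := by
  obtain ⟨w, hw, hw0⟩ := Submodule.exists_mem_ne_zero_of_ne_bot hχ
  have h1 := mem_weightSpace.1 hw 1
  rw [map_one, End.one_apply] at h1
  exact smul_left_injective ℂ hw0 (h1.symm.trans (one_smul ℂ w).symm)

/-- A weight as a linear character. -/
def weightHom {τ : Representation ℂ M W} {χ : M → ℂ} (hχ : χ ∈ weights τ) : M →* ℂ where
  toFun := χ
  map_one' := weights_map_one hχ
  map_mul' := weights_map_mul hχ

theorem eq_one_of_forall_weights [Finite M] [FiniteDimensional ℂ W] {τ : Representation ℂ M W}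
    (hτ : Function.Injective τ) {m : M} (h : ∀ χ ∈ weights τ, χ m = 1) : m = 1 := by
  refine hτ ?_
  rw [map_one]
  have h1 : (⊤ : Submodule ℂ W) ≤ LinearMap.eqLocus (τ m) 1 := by
    rw [← iSup_weightSpace_eq_top τ]
    refine iSup_le fun χ w hw => ?_
    by_cases hχ : χ ∈ weights τ
    · have := mem_weightSpace.1 hw m
      rw [h χ hχ, one_smul] at this
      exact this
    · have : weightSpace τ χ = ⊥ := not_not.1 hχ
      rw [this, Submodule.mem_bot] at hw
      rw [hw]; simp
  ext w
  exact h1 (Submodule.mem_top (x := w))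

theorem sum_finrank_weightSpace_le [Finite M] [FiniteDimensional ℂ W] (τ : Representation ℂ M W)
    (T : Finset (M → ℂ)) : ∑ χ ∈ T, finrank ℂ (weightSpace τ χ) ≤ finrank ℂ W := by
  classical
  have h1 : iSupIndep fun χ : T => weightSpace τ χ :=
    (iSupIndep_weightSpace τ).comp Subtype.val_injective
  have h2 := LinearMap.finrank_le_finrank_of_injective
    (f := DirectSum.coeLinearMap fun χ : T => weightSpace τ χ) h1.dfinsupp_lsum_injective
  rwa [Module.finrank_directSum, Finset.sum_coe_sort T fun χ => finrank ℂ (weightSpace τ χ)] at h2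

/-- A subgroup of order `p ^ k` and exponent `p` meets at least `k` weights nontrivially. -/
theorem le_card_weights {p k : ℕ} (hp : p.Prime) [Finite M] [FiniteDimensional ℂ W]
    {τ : Representation ℂ M W} (hτ : Function.Injective τ) (hexp : ∀ m : M, m ^ p = 1)
    {K : Subgroup M} (hK : Nat.card K = p ^ k) {T : Finset (M → ℂ)}
    (hT : ∀ χ ∈ weights τ, (∃ m ∈ K, χ m ≠ 1) → χ ∈ T) (hTw : ∀ χ ∈ T, χ ∈ weights τ) :
    k ≤ T.card := by
  have : NeZero p := ⟨hp.ne_zero⟩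
  -- Evaluation embeds `K` into `μ_p ^ T`, as weights outside `T` are trivial on `K` and `τ` is
  -- faithful.
  let f : K → (T → rootsOfUnity p ℂ) := fun m χ =>
    rootsOfUnity.mkOfPowEq (χ.1 m) (by
      have h1 := map_pow (weightHom (hTw χ χ.2)) (m : M) p
      rw [hexp, map_one] at h1
      exact h1.symm)
  have hf : Function.Injective f := by
    intro a b hab
    have h1 : (a : M) * (b : M)⁻¹ = 1 := by
      refine eq_one_of_forall_weights hτ fun χ hχ => ?_
      by_contra hne
      have hχT := hT χ hχ ⟨_, K.mul_mem a.2 (K.inv_mem b.2), hne⟩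
      have h2 : χ a = χ b := by
        exact congrArg (fun z : rootsOfUnity p ℂ => ((z : ℂˣ) : ℂ)) (congrFun hab ⟨χ, hχT⟩)
      rw [weights_map_mul hχ, h2, ← weights_map_mul hχ, mul_inv_cancel, weights_map_one hχ] at hne
      exact hne rfl
    exact Subtype.ext (mul_inv_eq_one.1 h1)
  have h1 := Nat.card_le_card_of_injective f hf
  rw [hK, Nat.card_fun, Nat.card_eq_fintype_card (α := T), Fintype.card_coe] at h1
  exact (Nat.pow_le_pow_iff_right hp.one_lt).1
    (h1.trans (Nat.pow_le_pow_left (card_rootsOfUnity ℂ p) _))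

end weights

/-! ### Linear independence by traces. -/

/-- Operators that are pairwise scaled nontrivially by conjugation are linearly independent. -/
theorem card_le_finrank_sq {G U : Type*} [Group G] [AddCommGroup U] [Module ℂ U]
    [FiniteDimensional ℂ U] [Nontrivial U] (σ : Representation ℂ G U) {J : Type*} [Fintype J]
    (s : J → G) (h : ∀ i j, i ≠ j → ∃ (g : G) (c : ℂ), c ≠ 1 ∧
      σ (g * (s i * (s j)⁻¹) * g⁻¹) = c • σ (s i * (s j)⁻¹)) :
    Fintype.card J ≤ Module.finrank ℂ U ^ 2 := by
  classical
  -- A conjugate has the same trace, and here it is a multiple by `c ≠ 1`.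
  have htr : ∀ i j, i ≠ j → LinearMap.trace ℂ U (σ (s i * (s j)⁻¹)) = 0 := by
    intro i j hij
    obtain ⟨g, c, hc, hg⟩ := h i j hij
    have h1 : LinearMap.trace ℂ U (σ (g * (s i * (s j)⁻¹) * g⁻¹)) =
        LinearMap.trace ℂ U (σ (s i * (s j)⁻¹)) := by
      rw [map_mul, LinearMap.trace_mul_comm, ← map_mul, inv_mul_cancel_left]
    rw [hg, map_smul, smul_eq_mul] at h1
    have h2 : (c - 1) * LinearMap.trace ℂ U (σ (s i * (s j)⁻¹)) = 0 := by
      rw [sub_mul, h1, one_mul, sub_self]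
    exact (mul_eq_zero.1 h2).resolve_left (sub_ne_zero.2 hc)
  have hli : LinearIndependent ℂ fun i => σ (s i) := by
    rw [Fintype.linearIndependent_iff]
    intro a ha j
    have h1 : ∑ i, a i * LinearMap.trace ℂ U (σ (s i * (s j)⁻¹)) = 0 := by
      have h2 := congrArg (fun f => LinearMap.trace ℂ U (f * σ (s j)⁻¹)) ha
      simpa [Finset.sum_mul, ← map_mul] using h2
    rw [Finset.sum_eq_single j (fun i _ hij => by rw [htr i j hij, mul_zero])
      (fun hj => absurd (Finset.mem_univ j) hj), mul_inv_cancel, map_one, LinearMap.trace_one] at h1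
    exact (mul_eq_zero.1 h1).resolve_right (Nat.cast_ne_zero.2 Module.finrank_pos.ne')
  have := hli.fintype_card_le_finrank
  rwa [Module.finrank_linearMap, ← sq] at this

/-! ### Central extensions and the lower bound. -/

/-- The central extension of `V` by `Z` defined by the bilinear cocycle `γ`. -/
@[ext]
structure CentralExt {V Z : Type*} [AddCommGroup V] [AddCommGroup Z] (γ : V →+ V →+ Z) where
  fst : V
  snd : Z

namespace CentralExt

variable {V Z : Type*} [AddCommGroup V] [AddCommGroup Z] (γ : V →+ V →+ Z)

instance : Mul (CentralExt γ) := ⟨fun a b => ⟨a.fst + b.fst, a.snd + b.snd + γ a.fst b.fst⟩⟩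
instance : One (CentralExt γ) := ⟨⟨0, 0⟩⟩
instance : Inv (CentralExt γ) := ⟨fun a => ⟨-a.fst, -a.snd + γ a.fst a.fst⟩⟩

variable {γ}

@[simp] theorem fst_mul (a b : CentralExt γ) : (a * b).fst = a.fst + b.fst := rfl
@[simp] theorem snd_mul (a b : CentralExt γ) :
    (a * b).snd = a.snd + b.snd + γ a.fst b.fst := rfl
@[simp] theorem fst_one : (1 : CentralExt γ).fst = 0 := rfl
@[simp] theorem snd_one : (1 : CentralExt γ).snd = 0 := rfl
@[simp] theorem fst_inv (a : CentralExt γ) : a⁻¹.fst = -a.fst := rfl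
@[simp] theorem snd_inv (a : CentralExt γ) : a⁻¹.snd = -a.snd + γ a.fst a.fst := rfl

instance : Group (CentralExt γ) :=
  Group.ofLeftAxioms
    (fun a b c => by ext <;> simp <;> abel)
    (fun a => by ext <;> simp)
    (fun a => by ext <;> simp)

/-- The underlying type is `V × Z`. -/
def equivProd : CentralExt γ ≃ V × Z where
  toFun a := (a.fst, a.snd)
  invFun a := ⟨a.1, a.2⟩

theorem card_eq : Nat.card (CentralExt γ) = Nat.card V * Nat.card Z := by
  rw [Nat.card_congr equivProd, Nat.card_prod]

instance [Finite V] [Finite Z] : Finite (CentralExt γ) := Finite.of_equiv _ equivProd.symm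

variable (γ) in
/-- The inclusion of the central subgroup `Z`. -/
def inclusion : Multiplicative Z →* CentralExt γ where
  toFun z := ⟨0, z.toAdd⟩
  map_one' := rfl
  map_mul' a b := by ext <;> simp

theorem inclusion_injective : Function.Injective (inclusion γ) := fun _ _ h =>
  congrArg CentralExt.snd h

theorem inclusion_mul_comm (z : Multiplicative Z) (g : CentralExt γ) :
    inclusion γ z * g = g * inclusion γ z := by
  ext <;> simp [inclusion, add_comm]

theorem conj_eq (g a : CentralExt γ) : g * a * g⁻¹ =
    inclusion γ (Multiplicative.ofAdd (γ g.fst a.fst - γ a.fst g.fst)) * a := by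
  ext
  · simp [inclusion]
  · simp [inclusion]; abel

/-- The weight space is `G`-stable since `Z` is central. For distinct `v`, `w` in `J`, some
conjugation multiplies the lift of `v - w` by a `z` with `χ z ≠ 1`, so the trace argument applies.
-/
theorem card_le_sq_finrank_weightSpace [Finite V] [Finite Z] {W : Type*} [AddCommGroup W]
    [Module ℂ W] [FiniteDimensional ℂ W] (ρ : Representation ℂ (CentralExt γ) W)
    {χ : Multiplicative Z → ℂ} (hχ : χ ∈ weights (ρ.comp (inclusion γ))) {K : AddSubgroup Z}
    (hK : ∃ z ∈ K, χ (Multiplicative.ofAdd z) ≠ 1) {J : Finset V}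
    (hJ : ∀ v ∈ J, ∀ w ∈ J, v ≠ w → ∀ z ∈ K, ∃ u, γ u (v - w) - γ (v - w) u = z) :
    J.card ≤ Module.finrank ℂ (weightSpace (ρ.comp (inclusion γ)) χ) ^ 2 := by
  have : Nontrivial (weightSpace (ρ.comp (inclusion γ)) χ) :=
    Submodule.nontrivial_iff_ne_bot.2 hχ
  let σ : Subrepresentation ρ := ⟨weightSpace (ρ.comp (inclusion γ)) χ, fun g w hw => by
    rw [mem_weightSpace] at hw ⊢
    intro m
    have h1 : ρ (inclusion γ m) w = χ m • w := hw m
    change ρ (inclusion γ m) (ρ g w) = _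
    rw [← Module.End.mul_apply, ← map_mul, inclusion_mul_comm, map_mul, Module.End.mul_apply, h1,
      map_smul]⟩
  obtain ⟨z, hz, hz1⟩ := hK
  have := card_le_finrank_sq σ.toRepresentation (J := J) (fun v => ⟨v, 0⟩) fun i j hij => by
    obtain ⟨u, hu⟩ := hJ i i.2 j j.2 (fun h => hij (Subtype.ext h)) z hz
    refine ⟨⟨u, 0⟩, χ (Multiplicative.ofAdd z), hz1, ?_⟩
    have h2 : (⟨i, 0⟩ * (⟨j, 0⟩ : CentralExt γ)⁻¹ : CentralExt γ).fst = (i : V) - j := by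
      simp [sub_eq_add_neg]
    rw [conj_eq, h2, hu, map_mul]
    ext w
    exact mem_weightSpace.1 ((σ.toRepresentation _ w).2) (Multiplicative.ofAdd z)
  rwa [Fintype.card_coe] at this

/-- At least `r` weights are nontrivial, at least `k` of them already on `K`. The latter have
multiplicity at least `d₁`, the rest at least `d₂`. -/
theorem le_rdim {p r k d₁ d₂ : ℕ} (hp : p.Prime) [Finite V] [Finite Z]
    (hexp : ∀ z : Z, p • z = 0) (hZ : Nat.card Z = p ^ r) {K : AddSubgroup Z}
    (hK : Nat.card K = p ^ k) {J₁ J₂ : Finset V}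
    (hJ₁ : ∀ v ∈ J₁, ∀ w ∈ J₁, v ≠ w → ∀ z ∈ K, ∃ u, γ u (v - w) - γ (v - w) u = z)
    (hJ₂ : ∀ v ∈ J₂, ∀ w ∈ J₂, v ≠ w → ∀ z, ∃ u, γ u (v - w) - γ (v - w) u = z)
    (h₁ : (d₁ - 1) ^ 2 < J₁.card) (h₂ : (d₂ - 1) ^ 2 < J₂.card) (hd : d₂ ≤ d₁) :
    k * d₁ + (r - k) * d₂ ≤ rdim (CentralExt γ) := by
  classical
  obtain ⟨ρ, hρ⟩ := exists_injective_representation_rdim (CentralExt γ)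
  let τ : Representation ℂ (Multiplicative Z) (Fin (rdim (CentralExt γ)) → ℂ) :=
    ρ.comp (inclusion γ)
  have hτ : Function.Injective τ := hρ.comp inclusion_injective
  have hexp' : ∀ m : Multiplicative Z, m ^ p = 1 := hexp
  let T : Finset (Multiplicative Z → ℂ) :=
    (finite_weights τ).toFinset.filter fun χ => ∃ m, χ m ≠ 1
  let T₁ : Finset (Multiplicative Z → ℂ) := T.filter fun χ => ∃ m ∈ K.toSubgroup, χ m ≠ 1
  have hT : ∀ χ, χ ∈ T ↔ χ ∈ weights τ ∧ ∃ m, χ m ≠ 1 := by simp [T]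
  have hT₁ : ∀ χ, χ ∈ T₁ ↔ χ ∈ T ∧ ∃ m ∈ K.toSubgroup, χ m ≠ 1 := by simp [T₁]
  have hr : r ≤ T.card := by
    refine le_card_weights hp hτ hexp' (K := ⊤) ?_ (fun χ hχ ⟨m, _, hm⟩ => (hT χ).2 ⟨hχ, m, hm⟩)
      fun χ hχ => ((hT χ).1 hχ).1
    rw [Subgroup.card_top, Nat.card_congr Multiplicative.toAdd, hZ]
  have hk : k ≤ T₁.card := by
    refine le_card_weights hp hτ hexp' (K := K.toSubgroup) hK ?_ fun χ hχ =>
      ((hT χ).1 ((hT₁ χ).1 hχ).1).1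
    rintro χ hχ ⟨m, hmK, hm⟩
    exact (hT₁ χ).2 ⟨(hT χ).2 ⟨hχ, m, hm⟩, m, hmK, hm⟩
  have hsq : ∀ {d f : ℕ}, (d - 1) ^ 2 < f ^ 2 → d ≤ f := fun {d f} h => by
    have := lt_of_pow_lt_pow_left₀ 2 (Nat.zero_le f) h
    omega
  have hdim₁ : ∀ χ ∈ T₁, d₁ ≤ Module.finrank ℂ (weightSpace τ χ) := by
    intro χ hχ
    obtain ⟨h1, m, hm, hm1⟩ := (hT₁ χ).1 hχ
    exact hsq (h₁.trans_le
      (card_le_sq_finrank_weightSpace ρ ((hT χ).1 h1).1 ⟨m.toAdd, hm, hm1⟩ hJ₁))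
  have hdim₂ : ∀ χ ∈ T, d₂ ≤ Module.finrank ℂ (weightSpace τ χ) := by
    intro χ hχ
    obtain ⟨h1, m, hm1⟩ := (hT χ).1 hχ
    exact hsq (h₂.trans_le (card_le_sq_finrank_weightSpace ρ h1 (K := ⊤)
      ⟨m.toAdd, AddSubgroup.mem_top _, hm1⟩ fun v hv w hw hvw z _ => hJ₂ v hv w hw hvw z))
  have hsub : T₁ ⊆ T := Finset.filter_subset _ _
  have hsum := sum_finrank_weightSpace_le τ T
  rw [Module.finrank_fin_fun, ← Finset.sum_sdiff hsub] at hsum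
  have hs₁ := Finset.card_nsmul_le_sum T₁ _ d₁ hdim₁
  have hs₂ := Finset.card_nsmul_le_sum (T \ T₁) (fun χ => Module.finrank ℂ (weightSpace τ χ)) d₂
    fun χ hχ => hdim₂ χ (Finset.sdiff_subset hχ)
  have hcard := Finset.card_sdiff_add_card_eq_card hsub
  rw [smul_eq_mul] at hs₁ hs₂
  -- More than `k` weights may be nontrivial on `K`; the `a` extra ones make up for missing weights
  -- outside `T₁`, as `d₂ ≤ d₁`.
  obtain ⟨a, ha⟩ := Nat.exists_eq_add_of_le hk
  have hrk : r - k ≤ a + (T \ T₁).card := by omega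
  calc k * d₁ + (r - k) * d₂ ≤ k * d₁ + (a + (T \ T₁).card) * d₂ := by gcongr
    _ ≤ k * d₁ + (a * d₁ + (T \ T₁).card * d₂) := by rw [add_mul]; gcongr
    _ = (T \ T₁).card * d₂ + T₁.card * d₁ := by rw [ha]; ring
    _ ≤ _ := (add_le_add hs₂ hs₁).trans hsum

end CentralExt

/-! ### Groups of large representation dimension. -/

namespace CentralExt

/-- A biadditive map from its values. -/
def mkBiadditive {V Z : Type*} [AddCommGroup V] [AddCommGroup Z] (f : V → V → Z)
    (hl : ∀ u v w, f (u + v) w = f u w + f v w) (hr : ∀ u v w, f u (v + w) = f u v + f u w) :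
    V →+ V →+ Z :=
  AddMonoidHom.mk' (fun u => AddMonoidHom.mk' (f u) (hr u)) fun u v => by ext w; exact hl u v w

theorem exists_group_le_rdim_elementary {p : ℕ} (hp : p.Prime) (r : ℕ) :
    ∃ (G : Type) (_ : Group G), Nat.card G = p ^ r ∧ r ≤ rdim G := by
  have := Fact.mk hp
  have hZ : Nat.card (Fin r → ZMod p) = p ^ r := by simp
  refine ⟨CentralExt (0 : PUnit →+ PUnit →+ (Fin r → ZMod p)), inferInstance, ?_, ?_⟩
  · rw [card_eq, hZ, Nat.card_unique, one_mul]
  · have := le_rdim (γ := (0 : PUnit →+ PUnit →+ (Fin r → ZMod p))) (K := ⊤) (k := r) (d₁ := 1)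
      (d₂ := 1) (J₁ := {0}) (J₂ := {0}) hp (fun z => by ext; simp) hZ
      (by rw [AddSubgroup.card_top, hZ]) (by simp) (by simp) (by simp) (by simp) le_rfl
    simpa using this

theorem exists_surjective_galoisField {p m r : ℕ} [Fact p.Prime] (hm : m ≠ 0) (hr : r ≤ m) :
    ∃ π : GaloisField p m →ₗ[ZMod p] (Fin r → ZMod p), Function.Surjective π := by
  let e : GaloisField p m ≃ₗ[ZMod p] (Fin m → ZMod p) :=
    LinearEquiv.ofFinrankEq _ _ (by rw [GaloisField.finrank p hm, Module.finrank_fin_fun])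
  refine ⟨(LinearMap.funLeft (ZMod p) (ZMod p) (Fin.castLE hr)).comp e.toLinearMap, ?_⟩
  exact (LinearMap.funLeft_surjective_of_injective (ZMod p) (ZMod p) _ (Fin.castLE_injective hr)).comp
    e.surjective

/-- The Heisenberg group over `F = GF(p ^ m)`, with centre `F` pushed forward along a linear
surjection onto `F_p ^ r`. Division in `F` shows that every nonzero vector has commutators filling
the centre. -/
theorem exists_group_le_rdim_heisenberg {p m r : ℕ} (hp : p.Prime) (hm : m ≠ 0) (hr : r ≤ m) :
    ∃ (G : Type) (_ : Group G), Nat.card G = p ^ (2 * m + r) ∧ r * p ^ m ≤ rdim G := by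
  classical
  have := Fact.mk hp
  obtain ⟨π, hπ⟩ := exists_surjective_galoisField (p := p) hm hr
  let F := GaloisField p m
  have : Finite F := inferInstanceAs (Finite (GaloisField p m))
  have : Fintype F := Fintype.ofFinite F
  have hF : Nat.card F = p ^ m := GaloisField.card p m hm
  have hZ : Nat.card (Fin r → ZMod p) = p ^ r := by simp
  let γ : F × F →+ F × F →+ (Fin r → ZMod p) := mkBiadditive (fun v w => π (v.1 * w.2))
    (fun u v w => by simp [add_mul]) (fun u v w => by simp [mul_add])
  have hγ : ∀ v w, γ v w = π (v.1 * w.2) := fun _ _ => rfl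
  refine ⟨CentralExt γ, inferInstance, ?_, ?_⟩
  · rw [card_eq, hZ, Nat.card_prod, hF]; ring
  · have hJ : ∀ v ∈ (Finset.univ : Finset (F × F)), ∀ w ∈ (Finset.univ : Finset (F × F)), v ≠ w →
        ∀ z, ∃ u, γ u (v - w) - γ (v - w) u = z := by
      intro v _ w _ hvw z
      obtain ⟨f, rfl⟩ := hπ z
      obtain ⟨x, hx⟩ : ∃ x, x = v - w := ⟨_, rfl⟩
      have hx0 : x ≠ 0 := hx ▸ sub_ne_zero.2 hvw
      rw [← hx]
      by_cases h2 : x.2 = 0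
      · have h1 : x.1 ≠ 0 := fun h1 => hx0 (Prod.ext h1 h2)
        refine ⟨(0, -(f / x.1)), ?_⟩
        rw [hγ, hγ, zero_mul, map_zero, zero_sub, ← map_neg, mul_neg, neg_neg, mul_div_cancel₀ _ h1]
      · refine ⟨(f / x.2, 0), ?_⟩
        rw [hγ, hγ, mul_zero, map_zero, sub_zero, div_mul_cancel₀ _ h2]
    have hcard : (p ^ m - 1) ^ 2 < (Finset.univ : Finset (F × F)).card := by
      rw [Finset.card_univ, ← Nat.card_eq_fintype_card, Nat.card_prod, hF, ← sq]
      exact Nat.pow_lt_pow_left (Nat.sub_lt (pow_pos hp.pos m) one_pos) two_ne_zero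
    have := le_rdim (γ := γ) (K := ⊤) (k := r) hp (fun z => by ext; simp) hZ
      (by rw [AddSubgroup.card_top, hZ]) (fun v hv w hw h z _ => hJ v hv w hw h z) hJ hcard hcard
      le_rfl
    simpa using this

/-- The Heisenberg group over `F_p` times a cyclic group of order `p`: one weight of multiplicity
`p` and one more. -/
theorem exists_group_le_rdim_four {p : ℕ} (hp : p.Prime) :
    ∃ (G : Type) (_ : Group G), Nat.card G = p ^ 4 ∧ p + 1 ≤ rdim G := by
  have := Fact.mk hp
  let γ : ZMod p × ZMod p →+ ZMod p × ZMod p →+ ZMod p × ZMod p :=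
    mkBiadditive (fun v w => (v.1 * w.2, 0)) (fun u v w => by simp [add_mul])
      (fun u v w => by simp [mul_add])
  have hγ : ∀ v w, γ v w = (v.1 * w.2, 0) := fun _ _ => rfl
  have hZ : Nat.card (ZMod p × ZMod p) = p ^ 2 := by simp [sq]
  refine ⟨CentralExt γ, inferInstance, ?_, ?_⟩
  · rw [card_eq, hZ]; ring
  · have hJ : ∀ v ∈ (Finset.univ : Finset (ZMod p × ZMod p)),
        ∀ w ∈ (Finset.univ : Finset (ZMod p × ZMod p)), v ≠ w →
        ∀ z ∈ (⊤ : AddSubgroup (ZMod p)).prod (⊥ : AddSubgroup (ZMod p)),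
        ∃ u, γ u (v - w) - γ (v - w) u = z := by
      intro v _ w _ hvw z hz
      have hz2 : z.2 = 0 := (AddSubgroup.mem_prod.1 hz).2
      obtain ⟨x, hx⟩ : ∃ x, x = v - w := ⟨_, rfl⟩
      have hx0 : x ≠ 0 := hx ▸ sub_ne_zero.2 hvw
      rw [← hx]
      by_cases h2 : x.2 = 0
      · have h1 : x.1 ≠ 0 := fun h1 => hx0 (Prod.ext h1 h2)
        refine ⟨(0, -(z.1 / x.1)), ?_⟩
        rw [hγ, hγ]
        ext
        · simp [mul_div_cancel₀ _ h1]
        · simp [hz2]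
      · refine ⟨(z.1 / x.2, 0), ?_⟩
        rw [hγ, hγ]
        ext
        · simp [div_mul_cancel₀ _ h2]
        · simp [hz2]
    have := le_rdim (γ := γ) (K := (⊤ : AddSubgroup (ZMod p)).prod ⊥) (k := 1) (d₁ := p) (d₂ := 1)
      (J₁ := Finset.univ) (J₂ := {0}) hp (fun z => by ext <;> simp) hZ
      (by rw [Nat.card_congr (AddSubgroup.prodEquiv _ _).toEquiv]; simp) hJ
      (by simp) (by
        rw [Finset.card_univ, ← Nat.card_eq_fintype_card, hZ]
        exact Nat.pow_lt_pow_left (Nat.sub_lt hp.pos one_pos) two_ne_zero) (by simp) hp.one_le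
    simpa using this

theorem exists_group_le_rdim_seven :
    ∃ (G : Type) (_ : Group G), Nat.card G = 2 ^ 7 ∧ 10 ≤ rdim G := by
  let V := ZMod 2 × ZMod 2 × ZMod 2 × ZMod 2
  let Z := ZMod 2 × ZMod 2 × ZMod 2
  -- The first two coordinates are multiplication in `F₄ = F₂[ω]`, `ω ^ 2 = ω + 1`, applied to `v.1
  -- + v.2.1 ω` and `w.2.2.1 + w.2.2.2 ω`. The third adds a degenerate form that still forces
  -- multiplicity 2, giving `2 * 4 + 2`.
  let f : V → V → Z := fun v w => (v.1 * w.2.2.1 + v.2.1 * w.2.2.2,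
    v.1 * w.2.2.2 + v.2.1 * w.2.2.1 + v.2.1 * w.2.2.2, v.1 * w.2.1)
  let γ : V →+ V →+ Z := mkBiadditive f
    (fun u v w => by
      refine Prod.ext ?_ (Prod.ext ?_ ?_) <;> simp [f, V, Z] <;> ring)
    (fun u v w => by
      refine Prod.ext ?_ (Prod.ext ?_ ?_) <;> simp [f, V, Z] <;> ring)
  have hZ : Nat.card Z = 2 ^ 3 := by simp [Z]
  have hV : Nat.card V = 2 ^ 4 := by simp [V]
  have key : ∀ x : V, x ≠ 0 → ∀ z : Z, z.2.2 = 0 → ∃ u, f u x - f x u = z := by decide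
  have key' : ∀ z : Z, ∃ u, f u (1, 0, 0, 0) - f (1, 0, 0, 0) u = z := by decide
  refine ⟨CentralExt γ, inferInstance, ?_, ?_⟩
  · rw [card_eq, hZ, hV]; norm_num
  · have := le_rdim (γ := γ)
      (K := (⊤ : AddSubgroup (ZMod 2)).prod ((⊤ : AddSubgroup (ZMod 2)).prod ⊥)) (k := 2)
      (d₁ := 4) (d₂ := 2) (J₁ := Finset.univ) (J₂ := {0, (1, 0, 0, 0)}) Nat.prime_two
      (by decide) hZ
      (by
        rw [Nat.card_congr (AddSubgroup.prodEquiv _ _).toEquiv, Nat.card_prod,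
          Nat.card_congr (AddSubgroup.prodEquiv _ _).toEquiv]
        simp)
      (fun v _ w _ hvw z hz => key (v - w) (sub_ne_zero.2 hvw) z hz.2.2)
      (fun v hv w hw hvw z => by
        have h1 : v - w = (1, 0, 0, 0) := by
          revert v w; decide
        rw [h1]; exact key' z)
      (by decide) (by decide) (by norm_num)
    simpa using this

end CentralExt

/-! ### Evaluation of `fMax` and conclusion. -/

theorem fMax_le_iff {p n v : ℕ} :
    fMax p n ≤ v ↔ ∀ r, 1 ≤ r → r ≤ n → r * p ^ ((n - r) / 2) ≤ v := by
  simp only [fMax, Finset.sup_le_iff, Finset.mem_Icc, and_imp]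

theorem mul_pow_sub_le {p a b c j k : ℕ} (hj : j ≤ k) (h : a * b ≤ c * p ^ j) :
    a * b * p ^ (k - j) ≤ c * p ^ k := by
  calc a * b * p ^ (k - j) ≤ c * p ^ j * p ^ (k - j) := Nat.mul_le_mul_right _ h
    _ = c * p ^ k := by rw [mul_assoc, ← pow_add, Nat.add_sub_cancel' hj]

theorem succ_le_pow {p : ℕ} (hp : 2 ≤ p) (j : ℕ) : j + 1 ≤ p ^ j :=
  Nat.lt_pow_self (Nat.lt_of_lt_of_le one_lt_two hp)

theorem two_mul_succ_le_pow {p : ℕ} (hp : 3 ≤ p) (j : ℕ) : 2 * j + 1 ≤ p ^ j := by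
  induction j with
  | zero => simp
  | succ j ih => rw [pow_succ]; nlinarith

theorem two_mul_add_two_le (j : ℕ) : 2 * (2 * j + 1) ≤ 3 * 2 ^ j := by
  induction j with
  | zero => simp
  | succ j ih =>
    rcases j with _ | j
    · simp
    · rw [pow_succ]; omega

/-- The term `r = 1` dominates: two steps in `r` cost a factor `p ≥ 3`. For even `n` the dominant
term is `r = 2`, and for `p = 2` with odd `n ≥ 3` it is `r = 3`. -/
theorem fMax_odd_le {p : ℕ} (hp : 3 ≤ p) (k : ℕ) : fMax p (2 * k + 1) ≤ p ^ k := by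
  refine fMax_le_iff.2 fun r h1 h2 => ?_
  obtain ⟨j, rfl | rfl⟩ : ∃ j, r = 2 * j + 1 ∨ r = 2 * (j + 1) := by
    obtain ⟨j, h | h⟩ := Nat.even_or_odd' r
    · exact ⟨j - 1, by omega⟩
    · exact ⟨j, by omega⟩
  · rw [show (2 * k + 1 - (2 * j + 1)) / 2 = k - j by omega]
    simpa using mul_pow_sub_le (a := 1) (b := 2 * j + 1) (c := 1) (k := k) (by omega)
      (by simpa using two_mul_succ_le_pow hp j)
  · rw [show (2 * k + 1 - 2 * (j + 1)) / 2 = k - (j + 1) by omega]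
    simpa using mul_pow_sub_le (a := 2) (b := j + 1) (c := 1) (k := k) (by omega)
      (by have := two_mul_succ_le_pow hp (j + 1); omega)

theorem fMax_even_le {p : ℕ} (hp : 2 ≤ p) (k : ℕ) : fMax p (2 * k + 2) ≤ 2 * p ^ k := by
  refine fMax_le_iff.2 fun r h1 h2 => ?_
  obtain ⟨j, rfl | rfl⟩ : ∃ j, r = 2 * j + 1 ∨ r = 2 * (j + 1) := by
    obtain ⟨j, h | h⟩ := Nat.even_or_odd' r
    · exact ⟨j - 1, by omega⟩
    · exact ⟨j, by omega⟩
  · rw [show (2 * k + 2 - (2 * j + 1)) / 2 = k - j by omega]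
    simpa using mul_pow_sub_le (a := 1) (b := 2 * j + 1) (c := 2) (k := k) (by omega)
      (by have := succ_le_pow hp j; omega)
  · rw [show (2 * k + 2 - 2 * (j + 1)) / 2 = k - j by omega]
    exact mul_pow_sub_le (by omega) (by have := succ_le_pow hp j; omega)

theorem fMax_two_odd_le (k : ℕ) : fMax 2 (2 * k + 3) ≤ 3 * 2 ^ k := by
  refine fMax_le_iff.2 fun r h1 h2 => ?_
  obtain ⟨j, rfl | rfl⟩ : ∃ j, r = 2 * j + 1 ∨ r = 2 * (j + 1) := by
    obtain ⟨j, h | h⟩ := Nat.even_or_odd' r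
    · exact ⟨j - 1, by omega⟩
    · exact ⟨j, by omega⟩
  · rw [show (2 * k + 3 - (2 * j + 1)) / 2 = k + 1 - j by omega]
    have := mul_pow_sub_le (p := 2) (a := 2) (b := 2 * j + 1) (c := 3) (k := k + 1) (by omega)
      (two_mul_add_two_le j)
    rw [pow_succ, mul_assoc 2] at this
    omega
  · rw [show (2 * k + 3 - 2 * (j + 1)) / 2 = k - j by omega]
    exact mul_pow_sub_le (by omega) (by have := succ_le_pow le_rfl j; omega)

/-- The optimal `r` is realized by a Heisenberg group when `r ≤ (n - r) / 2`. The remaining small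
`n` are elementary abelian or exceptional. -/
theorem exists_group_fMax_le_rdim {p n : ℕ} (hp : p.Prime) (hn : 1 ≤ n)
    (he : ¬ IsExceptional p n) :
    ∃ (G : Type) (_ : Group G), Nat.card G = p ^ n ∧ fMax p n ≤ rdim G := by
  have elem : fMax p n ≤ n → ∃ (G : Type) (_ : Group G), Nat.card G = p ^ n ∧ fMax p n ≤ rdim G :=
    fun h => by
      obtain ⟨G, i, hc, hr⟩ := CentralExt.exists_group_le_rdim_elementary hp n
      exact ⟨G, i, hc, h.trans hr⟩
  have heis : ∀ m r, m ≠ 0 → r ≤ m → n = 2 * m + r → fMax p n ≤ r * p ^ m →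
      ∃ (G : Type) (_ : Group G), Nat.card G = p ^ n ∧ fMax p n ≤ rdim G := by
    rintro m r hm hr rfl h
    obtain ⟨G, i, hc, hr⟩ := CentralExt.exists_group_le_rdim_heisenberg hp hm hr
    exact ⟨G, i, hc, h.trans hr⟩
  obtain ⟨k, rfl | rfl⟩ : ∃ k, n = 2 * k + 1 ∨ n = 2 * k + 2 := by
    obtain ⟨j, h | h⟩ := Nat.even_or_odd' n
    · exact ⟨j - 1, by omega⟩
    · exact ⟨j, by omega⟩
  · rcases hp.eq_two_or_odd' with rfl | hodd
    · rcases k with _ | k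
      · exact elem (by decide)
      · have hf := fMax_two_odd_le k
        rcases Nat.lt_or_ge k 3 with hk | hk
        · interval_cases k
          · exact elem hf
          · exact absurd (Or.inl ⟨rfl, rfl⟩) he
          · exact absurd (Or.inr (Or.inl ⟨rfl, rfl⟩)) he
        · exact heis k 3 (by omega) hk (by omega) hf
    · have hp3 : 3 ≤ p := by
        have := hp.two_le
        obtain ⟨j, hj⟩ := hodd
        omega
      have hf := fMax_odd_le hp3 k
      rcases k with _ | k
      · exact elem hf
      · exact heis (k + 1) 1 (by omega) (by omega) rfl (by rwa [one_mul])
  · have hf := fMax_even_le hp.two_le k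
    rcases Nat.lt_or_ge k 2 with hk | hk
    · interval_cases k
      · exact elem (by simpa using hf)
      · rcases hp.eq_two_or_odd' with rfl | hodd
        · exact elem hf
        · exact absurd (Or.inr (Or.inr ⟨hodd, rfl⟩)) he
    · exact heis k 2 (by omega) hk rfl hf

theorem isGreatest_rdimValues {m v : ℕ} (hle : ∀ (G : Type u) [Group G], Nat.card G = m → rdim G ≤ v)
    (hex : ∃ (G : Type) (_ : Group G), Nat.card G = m ∧ v ≤ rdim G) :
    IsGreatest (rdimValues.{u} m) v := by
  obtain ⟨G, _, hc, hv⟩ := hex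
  have hc' : Nat.card (ULift.{u} G) = m := (Nat.card_congr Equiv.ulift).trans hc
  have he : rdim (ULift.{u} G) = rdim G := rdim_congr MulEquiv.ulift
  refine ⟨⟨ULift.{u} G, inferInstance, hc', le_antisymm (hle _ hc') (he ▸ hv)⟩, ?_⟩
  rintro _ ⟨H, _, hH, rfl⟩
  exact hle H hH

theorem theorem1p1 (p n : ℕ) (hp : p.Prime) (hn : 1 ≤ n) :
    (IsGreatest (rdimValues.{u} (p ^ n)) (fMax p n) ↔ ¬ IsExceptional p n) ∧
    (p = 2 → n = 5 → IsGreatest (rdimValues.{u} (p ^ n)) 5) ∧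
    (p = 2 → n = 7 → IsGreatest (rdimValues.{u} (p ^ n)) 10) ∧
    (Odd p → n = 4 → IsGreatest (rdimValues.{u} (p ^ n)) (p + 1)) := by
  have h5 : p = 2 → n = 5 → IsGreatest (rdimValues.{u} (p ^ n)) 5 := by
    rintro rfl rfl
    exact isGreatest_rdimValues (fun G _ hG => rdim_le_five_of_card_eq hG)
      (CentralExt.exists_group_le_rdim_elementary hp 5)
  have h7 : p = 2 → n = 7 → IsGreatest (rdimValues.{u} (p ^ n)) 10 := by
    rintro rfl rfl
    exact isGreatest_rdimValues (fun G _ hG => rdim_le_ten_of_card_eq hG)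
      CentralExt.exists_group_le_rdim_seven
  have h4 : Odd p → n = 4 → IsGreatest (rdimValues.{u} (p ^ n)) (p + 1) := by
    rintro hodd rfl
    exact isGreatest_rdimValues (fun G _ hG => rdim_le_add_one_of_card_eq_pow_four hp hodd hG)
      (CentralExt.exists_group_le_rdim_four hp)
  refine ⟨⟨fun hg => ?_, fun he => isGreatest_rdimValues (fun G _ hG => rdim_le_fMax hp hG hn)
    (exists_group_fMax_le_rdim hp hn he)⟩, h5, h7, h4⟩
  rintro (⟨rfl, rfl⟩ | ⟨rfl, rfl⟩ | ⟨hodd, rfl⟩)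
  · exact absurd (hg.unique (h5 rfl rfl)) (by decide)
  · exact absurd (hg.unique (h7 rfl rfl)) (by decide)
  -- The term `r = 2` of `fMax p 4` is `2 * p`, which exceeds `p + 1`.
  · have h1 := fMax_le_iff.1 (hg.unique (h4 hodd rfl)).le 2 (by norm_num) (by norm_num)
    norm_num at h1
    have := hp.two_le
    obtain ⟨j, hj⟩ := hodd
    omega
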